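/- **Setting.** A compact metric graph $\Gamma$ consists of finitely many intervals $[0,\ell_1],\dots,[0,\ell_m]$, $\ell_k>0$ (the edges), whose $2m$ endpoints are glued together according to a partition of the set of endpoints; the classes of the partition are the vertices. Loops and parallel edges are allowed. The total length is $L=\sum_k \ell_k$. Let $H^1(\Gamma)$ be the space of real continuous functions on $\Gamma$ whose restriction to every edge has a weak derivative in $L^2$. The standard (Kirchhoff) Laplacian on $\Gamma$ is the operator $A$ on $L^2(\Gamma)$ associated with the form $a(f,v)=\int_\Gamma f'v'\,dx$ on $H^1(\Gamma)$: $f\in D(A)$ and $Af=h\in L^2(\Gamma)$ iff $f\in H^1(\Gamma)$ and $a(f,v)=\int_\Gamma hv\,dx$ for all $v\in H^1(\Gamma)$. Let $\mu_1(\Gamma)\le\mu_2(\Gamma)\le\cdots$ be its eigenvalues, counted with multiplicities. A *flower graph* is a graph with only one vertex; it is *equilateral* if all its edges have the same length. **Theorem.** Let $\Gamma$ be a compact metric graph with total length $L>0$ and $m$ edges, which is not a single loop (that is, if $m=1$ then the two endpoints of the edge are not identified). Then $\mu_2(\Gamma)$ exists (there are two linearly independent eigenfunctions whose eigenvalues are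 at most $\mu_2(\Gamma)$, and $\mu_2(\Gamma)$ is the least number with this property) and $$\mu_2(\Gamma)\;\le\;\frac{\pi^2m^2}{L^2}\;=\;\frac{\pi^2}{(\text{mean edge length})^2},\qquad \text{mean edge length}=\frac Lm .$$ There is equality if $\Gamma$ is an equilateral flower graph (with $m\ge 2$ edges, since the single loop is excluded), but not only then: there is a compact metric graph with at least two edges which is not an equilateral flower graph and for which equality holds. -/

import Mathlib

open MeasureTheory Set

/-- A compact metric graph: finitely many compact intervals `[0, ℓ_k]` with `ℓ_k > 0`, together with
a partition, given as an equivalence relation, of the set of their `2m` endpoints into vertices.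
The endpoint `(k, false)` is the point `0`, and `(k, true)` the point `ℓ_k`, of the `k`-th interval.
Loops and parallel edges are allowed. -/
structure CompactMetricGraph where
  /-- the number `m` of edges -/
  numEdges : ℕ
  /-- the edge lengths `ℓ_k` -/
  len : Fin numEdges → ℝ
  len_pos : ∀ k, 0 < len k
  /-- two endpoints are related iff they belong to the same vertex -/
  glue : Setoid (Fin numEdges × Bool)

noncomputable section

namespace CompactMetricGraph

variable (Γ : CompactMetricGraph)

/-- The disjoint union of the intervals `[0, ℓ_k]`. -/
abbrev PrePoint : Type := Σ k : Fin Γ.numEdges, Icc (0 : ℝ) (Γ.len k)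

/-- The endpoints of the intervals, as points of the disjoint union. -/
def endpoint (s : Fin Γ.numEdges × Bool) : Γ.PrePoint :=
  ⟨s.1, if s.2 then ⟨Γ.len s.1, (Γ.len_pos s.1).le, le_rfl⟩
    else ⟨0, le_rfl, (Γ.len_pos s.1).le⟩⟩

theorem endpoint_injective : Function.Injective Γ.endpoint := by
  rintro ⟨k, b⟩ ⟨l, c⟩ h
  obtain rfl : k = l := congrArg Sigma.fst h
  have h2 := eq_of_heq (Sigma.mk.inj h).2
  have hp := (Γ.len_pos k).ne'
  cases b <;> cases c <;> simp_all [Subtype.ext_iff, eq_comm]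

/-- Two points of the disjoint union are identified iff they are equal or are endpoints belonging to
the same vertex. -/
def pointSetoid : Setoid Γ.PrePoint where
  r p q := p = q ∨ ∃ s t, Γ.glue s t ∧ p = Γ.endpoint s ∧ q = Γ.endpoint t
  iseqv :=
    { refl := fun _ => Or.inl rfl
      symm := by
        rintro p q (h | ⟨s, t, h, hp, hq⟩)
        · exact Or.inl h.symm
        · exact Or.inr ⟨t, s, Γ.glue.symm h, hq, hp⟩
      trans := by
        rintro p q r (rfl | ⟨s, t, h, hp, hq⟩) (rfl | ⟨s', t', h', hp', hq'⟩)
        · exact Or.inl rfl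
        · exact Or.inr ⟨s', t', h', hp', hq'⟩
        · exact Or.inr ⟨s, t, h, hp, hq⟩
        · obtain rfl : t = s' := Γ.endpoint_injective (hq.symm.trans hp')
          exact Or.inr ⟨s, t', Γ.glue.trans h h', hp, hq'⟩ }

/-- The metric graph as a set of points. -/
def Point : Type := Quotient Γ.pointSetoid

/-- The quotient topology: a set is open iff its intersection with every edge is. -/
instance : TopologicalSpace Γ.Point :=
  inferInstanceAs (TopologicalSpace (Quotient Γ.pointSetoid))

/-- The point of the `k`-th edge with local coordinate `x ∈ [0, ℓ_k]`. -/
def pt (k : Fin Γ.numEdges) (x : Icc (0 : ℝ) (Γ.len k)) : Γ.Point :=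
  Quotient.mk Γ.pointSetoid ⟨k, x⟩

/-- The total length `L` of the graph. -/
def totalLength : ℝ := ∑ k, Γ.len k

/-- The mean edge length. -/
def meanEdgeLength : ℝ := Γ.totalLength / Γ.numEdges

/-- All edges have the same length. -/
def IsEquilateral : Prop := ∀ k l, Γ.len k = Γ.len l

/-- A flower graph: all endpoints of edges belong to one and the same vertex. -/
def IsFlower : Prop := ∀ s t, Γ.glue s t

/-- A single loop: a graph with one edge, whose two endpoints form one vertex. -/
def IsSingleLoop : Prop := Γ.numEdges = 1 ∧ ∀ k, Γ.glue (k, false) (k, true)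

/-- A family of functions, one on each edge in its local coordinate; only the values of the `k`-th
function on `(0, ℓ_k)` matter. -/
abbrev EdgeFun : Type := Fin Γ.numEdges → ℝ → ℝ

variable {Γ}

/-- A function on the graph, expressed in the local coordinates of the edges (with irrelevant
values outside `[0, ℓ_k]`). -/
def onEdges (f : Γ.Point → ℝ) : Γ.EdgeFun := fun k =>
  IccExtend (Γ.len_pos k).le (fun x => f (Γ.pt k x))

/-- `g ∈ L²(Γ)`. -/
def MemL2 (g : Γ.EdgeFun) : Prop :=
  ∀ k, MemLp (g k) 2 (volume.restrict (Ioo 0 (Γ.len k)))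

/-- The inner product `∫_Γ g h dx = ∑_k ∫_0^{ℓ_k} g h dx` of `L²(Γ)`. -/
def innerL2 (g h : Γ.EdgeFun) : ℝ :=
  ∑ k, ∫ x in (0 : ℝ)..(Γ.len k), g k x * h k x

/-- `g` is the weak derivative of `f` on every edge. -/
def IsWeakDeriv (f g : Γ.EdgeFun) : Prop :=
  ∀ k, ∀ φ : ℝ → ℝ, ContDiff ℝ ((⊤ : ℕ∞) : WithTop ℕ∞) φ → HasCompactSupport φ →
    tsupport φ ⊆ Ioo 0 (Γ.len k) →
    ∫ x in (0 : ℝ)..(Γ.len k), g k x * φ x = -∫ x in (0 : ℝ)..(Γ.len k), f k x * deriv φ x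

/-- `f ∈ H¹(Γ)`, with (edgewise) weak derivative `f' ∈ L²(Γ)`: `f` is continuous on the graph, in
particular at the vertices, and its restriction to every edge lies in `H¹` of that edge. -/
def HasH1Deriv (f : Γ.Point → ℝ) (f' : Γ.EdgeFun) : Prop :=
  Continuous f ∧ MemL2 f' ∧ IsWeakDeriv (onEdges f) f'

/-- `f` lies in the domain of the operator `A` associated with the form
`a(f, v) = ∫_Γ f' v' dx` on `H¹(Γ)`, and `A f = h`. This `A` is the standard (Kirchhoff)
Laplacian. -/
def IsLaplacian (f : Γ.Point → ℝ) (h : Γ.EdgeFun) : Prop :=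
  MemL2 h ∧ ∃ f', HasH1Deriv f f' ∧
    ∀ v v', HasH1Deriv v v' → innerL2 f' v' = innerL2 h (onEdges v)

/-- `f` is an eigenfunction of the standard Laplacian for the eigenvalue `ν`. -/
def IsEigenfunction (ν : ℝ) (f : Γ.Point → ℝ) : Prop :=
  f ≠ 0 ∧ IsLaplacian f (onEdges (ν • f))

variable (Γ)

/-- The set of all `t` such that the standard Laplacian has at least `k` eigenvalues `≤ t`, counted
with multiplicities: there are `k` linearly independent eigenfunctions for eigenvalues `≤ t`. -/
def eigenvalueCountSet (k : ℕ) : Set ℝ :=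
  {t | ∃ u : Fin k → Γ.Point → ℝ, LinearIndependent ℝ u ∧
    ∀ i, ∃ ν ≤ t, IsEigenfunction ν (u i)}

/-- The `k`-th eigenvalue `μ_k(Γ)`, `k ≥ 1`, of the standard Laplacian, counted with multiplicities
in increasing order: the least `t` such that there are at least `k` eigenvalues `≤ t`. -/
def mu (k : ℕ) : ℝ := sInf (Γ.eigenvalueCountSet k)

end CompactMetricGraph

end

/-!
The second eigenvalue is treated through its variational characterization: `μ₂(Γ)` is the minimum of
the Rayleigh quotient `∫ u'² / ∫ u²` over the nonzero functions in `H¹(Γ)` with mean zero.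
By the lemma of du Bois-Reymond, `H¹(Γ)` consists of the continuous functions that are primitives of
square integrable functions on the edges (`hasH1Deriv_iff`). The minimum is attained
(`exists_rayleigh_minimizer`): by Arzelà–Ascoli a minimizing sequence has a uniformly convergent
subsequence, and by the parallelogram identity its derivatives converge in `L²(Γ)`. A minimizer is
an eigenfunction by the Euler–Lagrange equation and is linearly independent of the constant
eigenfunction. Conversely, two linearly independent eigenfunctions with eigenvalues `≤ t` have a
nonzero linear combination that satisfies any one prescribed linear condition and has Rayleigh
quotient `≤ t` (`exists_rayleigh_le_of_mem_eigenvalueCountSet`).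

For the upper bound with `m ≥ 2` edges, choose two edges of lengths `a`, `b` with `a + b ≥ 2 L / m`.
Closing them up to a loop of length `a + b` gives a trial function with Rayleigh quotient at
most `(2 π / (a + b))² ≤ π² m² / L²`; it takes the same value at all vertices, so that it is
continuous however the edges are glued. For `m = 1` the graph is an interval and
`cos (π x / L)` is used.

For the lower bounds in the cases of equality, a well-chosen linear condition reduces the claim to
Poincaré inequalities on intervals. In an equilateral flower the condition is that the function
vanishes at the vertex. A further case of equality is the circle of length two
with two opposite vertices; the condition there is that the values at the midpoints of the two edges
add up to zero. The Poincaré inequalities come from the pointwise inequality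
`(F' - F w' / w)² ≥ 0` with a positive solution `w` of `w'' = -ω² w`
(`IsPrimitiveOn.sq_mul_integral_sq_le`).
-/

/-! ### Primitives of integrable functions on an interval -/

/-- `F` is a primitive of the integrable function `g` on `[a, b]`; equivalently, `F` is absolutely
continuous there and `g` is its derivative almost everywhere. -/
def IsPrimitiveOn (F g : ℝ → ℝ) (a b : ℝ) : Prop :=
  IntervalIntegrable g volume a b ∧ ∀ x ∈ Icc a b, F x = F a + ∫ t in a..x, g t

namespace IsPrimitiveOn

variable {F g P q : ℝ → ℝ} {a b : ℝ}

theorem absolutelyContinuous (h : IsPrimitiveOn F g a b) :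
    AbsolutelyContinuousOnInterval (fun x => F a + ∫ t in a..x, g t) a b := by
  have h1 := h.1.absolutelyContinuousOnInterval_intervalIntegral (c := a) (by simp)
  have h2 : AbsolutelyContinuousOnInterval (fun _ : ℝ => F a) a b :=
    ContDiffOn.absolutelyContinuousOnInterval contDiffOn_const
  exact h2.add h1

theorem ae_deriv (h : IsPrimitiveOn F g a b) :
    ∀ᵐ x, x ∈ uIcc a b → deriv (fun x => F a + ∫ t in a..x, g t) x = g x := by
  filter_upwards [h.1.ae_hasDerivAt_integral] with x hx hx'
  exact ((hx hx' a (by simp)).const_add (F a)).deriv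

theorem mono (h : IsPrimitiveOn F g a b) {c d : ℝ} (hac : a ≤ c) (hcd : c ≤ d) (hdb : d ≤ b) :
    IsPrimitiveOn F g c d := by
  have hi : ∀ x ∈ Icc a b, ∀ y ∈ Icc a b, IntervalIntegrable g volume x y := by
    intro x hx y hy
    refine h.1.mono_set ?_
    rw [uIcc_of_le (hx.1.trans hx.2)]
    exact uIcc_subset_Icc hx hy
  have hc : c ∈ Icc a b := ⟨hac, hcd.trans hdb⟩
  have ha : a ∈ Icc a b := ⟨le_rfl, hac.trans hc.2⟩
  refine ⟨hi _ hc _ ⟨hac.trans hcd, hdb⟩, fun x hx => ?_⟩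
  have hx' : x ∈ Icc a b := ⟨hac.trans hx.1, hx.2.trans hdb⟩
  rw [h.2 x hx', h.2 c hc, add_assoc,
    intervalIntegral.integral_add_adjacent_intervals (hi _ ha _ hc) (hi _ hc _ hx')]

theorem continuousOn (h : IsPrimitiveOn F g a b) (hab : a ≤ b) : ContinuousOn F (Icc a b) := by
  have := h.absolutelyContinuous.continuousOn
  rw [uIcc_of_le hab] at this
  exact this.congr fun x hx => h.2 x hx

theorem intervalIntegrable_mul (h : IsPrimitiveOn F g a b) (hP : ContinuousOn P (Icc a b))
    (hab : a ≤ b) : IntervalIntegrable (fun x => g x * P x) volume a b :=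
  h.1.mul_continuousOn (by rwa [uIcc_of_le hab])

theorem add (hF : IsPrimitiveOn F g a b) (hP : IsPrimitiveOn P q a b) :
    IsPrimitiveOn (fun x => F x + P x) (fun x => g x + q x) a b := by
  refine ⟨hF.1.add hP.1, fun x hx => ?_⟩
  rw [intervalIntegral.integral_add (hF.mono le_rfl hx.1 hx.2).1 (hP.mono le_rfl hx.1 hx.2).1,
    add_add_add_comm, ← hF.2 x hx, ← hP.2 x hx]

theorem const_mul (hF : IsPrimitiveOn F g a b) (c : ℝ) :
    IsPrimitiveOn (fun x => c * F x) (fun x => c * g x) a b := by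
  refine ⟨hF.1.const_mul c, fun x hx => ?_⟩
  rw [intervalIntegral.integral_const_mul, ← mul_add, ← hF.2 x hx]

/-- The product rule for absolutely continuous functions. -/
theorem mul (hF : IsPrimitiveOn F g a b) (hP : IsPrimitiveOn P q a b) (hab : a ≤ b) :
    IsPrimitiveOn (fun x => F x * P x) (fun x => g x * P x + F x * q x) a b := by
  refine ⟨(hF.intervalIntegrable_mul (hP.continuousOn hab) hab).add ?_, fun x hx => ?_⟩
  · simpa only [mul_comm] using hP.intervalIntegrable_mul (hF.continuousOn hab) hab
  have hF' := hF.mono le_rfl hx.1 hx.2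
  have hP' := hP.mono le_rfl hx.1 hx.2
  have key := hF'.absolutelyContinuous.integral_deriv_mul_eq_sub hP'.absolutelyContinuous
  have hcongr : ∫ t in a..x, g t * P t + F t * q t = ∫ t in a..x,
      deriv (fun x => F a + ∫ t in a..x, g t) t * (P a + ∫ s in a..t, q s) +
      (F a + ∫ s in a..t, g s) * deriv (fun x => P a + ∫ t in a..x, q t) t := by
    refine intervalIntegral.integral_congr_ae ?_
    filter_upwards [hF'.ae_deriv, hP'.ae_deriv] with t h1 h2 ht
    have ht' := uIoc_subset_uIcc ht
    rw [h1 ht', h2 ht']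
    rw [uIcc_of_le hx.1] at ht'
    rw [hF'.2 t ht', hP'.2 t ht']
  rw [hcongr, key, ← hF'.2 x ⟨hx.1, le_rfl⟩, ← hP'.2 x ⟨hx.1, le_rfl⟩]
  simp

theorem of_hasDerivAt (hab : a ≤ b) (hd : ∀ x ∈ Icc a b, HasDerivAt F (g x) x)
    (hg : ContinuousOn g (Icc a b)) : IsPrimitiveOn F g a b := by
  have hi : ∀ x ∈ Icc a b, IntervalIntegrable g volume a x := fun x hx =>
    (hg.mono (by rw [uIcc_of_le hx.1]; exact Icc_subset_Icc_right hx.2)).intervalIntegrable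
  refine ⟨hi b ⟨hab, le_rfl⟩, fun x hx => ?_⟩
  rw [intervalIntegral.integral_eq_sub_of_hasDerivAt (fun t ht => hd t ?_) (hi x hx)]
  · ring
  · rw [uIcc_of_le hx.1] at ht
    exact ⟨ht.1, ht.2.trans hx.2⟩

theorem congr {G : ℝ → ℝ} (h : IsPrimitiveOn F g a b) (hG : EqOn G F (Icc a b)) (hab : a ≤ b) :
    IsPrimitiveOn G g a b :=
  ⟨h.1, fun x hx => by rw [hG hx, hG ⟨le_rfl, hab⟩, h.2 x hx]⟩

/-- Cauchy–Schwarz: a function whose derivative is square integrable is Hölder continuous with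
exponent `1/2`. -/
theorem sq_sub_le (h : IsPrimitiveOn F g a b)
    (hg : IntervalIntegrable (fun x => g x ^ 2) volume a b)
    {x y : ℝ} (hx : x ∈ Icc a b) (hy : y ∈ Icc a b) :
    (F x - F y) ^ 2 ≤ |x - y| * ∫ t in a..b, g t ^ 2 := by
  wlog hxy : x ≤ y generalizing x y
  · rw [← abs_sub_comm, show (F x - F y) ^ 2 = (F y - F x) ^ 2 by ring]
    exact this hy hx (le_of_not_ge hxy)
  have hab : a ≤ b := hx.1.trans hx.2
  rcases hxy.eq_or_lt with rfl | hlt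
  · simp
  have h' := h.mono hx.1 hxy hy.2
  have hg' : IntervalIntegrable (fun x => g x ^ 2) volume x y :=
    hg.mono_set (by rw [uIcc_of_le hxy, uIcc_of_le hab]; exact Icc_subset_Icc hx.1 hy.2)
  have hmono : ∫ t in x..y, g t ^ 2 ≤ ∫ t in a..b, g t ^ 2 :=
    intervalIntegral.integral_mono_interval hx.1 hxy hy.2
      (Filter.Eventually.of_forall fun t => sq_nonneg (g t)) hg
  have hF : F y - F x = ∫ t in x..y, g t := by rw [h'.2 y ⟨hxy, le_rfl⟩]; ring
  set m : ℝ := (∫ t in x..y, g t) / (y - x) with hm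
  have hyx : 0 < y - x := sub_pos.2 hlt
  have h0 : 0 ≤ ∫ t in x..y, (g t - m) ^ 2 :=
    intervalIntegral.integral_nonneg hxy fun t _ => sq_nonneg _
  have h1 : ∫ t in x..y, (g t - m) ^ 2
      = (∫ t in x..y, g t ^ 2) - 2 * m * (∫ t in x..y, g t) + m ^ 2 * (y - x) := by
    have : ∀ t, (g t - m) ^ 2 = g t ^ 2 - 2 * m * g t + m ^ 2 := fun t => by ring
    simp_rw [this]
    rw [intervalIntegral.integral_add (hg'.sub (h'.1.const_mul _)) (by simp),
      intervalIntegral.integral_sub hg' (h'.1.const_mul _), intervalIntegral.integral_const_mul]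
    simp; ring
  have h2 : (∫ t in x..y, g t) = m * (y - x) := by rw [hm]; field_simp
  rw [abs_sub_comm, abs_of_pos hyx, show (F x - F y) ^ 2 = (F y - F x) ^ 2 by ring, hF, h2]
  rw [h1, h2] at h0
  nlinarith [mul_le_mul_of_nonneg_left hmono hyx.le, mul_nonneg hyx.le h0]

/-- Let `w = cos (ω (x - c))`, a positive solution of `w'' = -ω² w` on `[a, b]`. The integral of
the square `(F' - F w' / w)²` equals `∫ F'² - ω² F²`, up to boundary terms that vanish at the end
points at which `F` or `w'` vanishes. This yields sharp Poincaré inequalities with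
Dirichlet conditions (`c` the midpoint) and mixed conditions (`c` an end point). -/
theorem sq_mul_integral_sq_le (h : IsPrimitiveOn F g a b) (hab : a ≤ b)
    (hg : IntervalIntegrable (fun x => g x ^ 2) volume a b) {ω c : ℝ}
    (hc : ∀ x ∈ Icc a b, |ω * (x - c)| < Real.pi / 2) (ha : F a = 0 ∨ a = c)
    (hb : F b = 0 ∨ b = c) :
    ω ^ 2 * ∫ x in a..b, F x ^ 2 ≤ ∫ x in a..b, g x ^ 2 := by
  have hcos : ∀ x ∈ Icc a b, 0 < Real.cos (ω * (x - c)) := fun x hx =>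
    Real.cos_pos_of_mem_Ioo (abs_lt.1 (hc x hx))
  set p : ℝ → ℝ := fun x => -ω * Real.tan (ω * (x - c)) with hp
  have hpd : ∀ x ∈ Icc a b, HasDerivAt p (-ω ^ 2 - p x ^ 2) x := by
    intro x hx
    have h1 : HasDerivAt (fun x => ω * (x - c)) ω x := by
      simpa using ((hasDerivAt_id x).sub_const c).const_mul ω
    have h2 := ((Real.hasDerivAt_tan (hcos x hx).ne').comp x h1).const_mul (-ω)
    convert! h2 using 1
    have := (hcos x hx).ne'
    simp only [hp, Real.tan_eq_sin_div_cos]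
    field_simp
    linear_combination (-ω ^ 2) * Real.sin_sq_add_cos_sq (ω * (x - c))
  have hpc : ContinuousOn p (Icc a b) := fun x hx => (hpd x hx).continuousAt.continuousWithinAt
  have hFc := h.continuousOn hab
  have hpP : IsPrimitiveOn p (fun x => -ω ^ 2 - p x ^ 2) a b :=
    of_hasDerivAt hab hpd (by fun_prop)
  have hprod := (h.mul h hab).mul hpP hab
  have hzero : ∫ x in a..b, (g x * F x + F x * g x) * p x + F x * F x * (-ω ^ 2 - p x ^ 2) = 0 := by
    have hB := hprod.2 b ⟨hab, le_rfl⟩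
    have e1 : F a * F a * p a = 0 := by
      rcases ha with ha | ha
      · simp [ha]
      · simp [hp, ha]
    have e2 : F b * F b * p b = 0 := by
      rcases hb with hb | hb
      · simp [hb]
      · simp [hp, hb]
    simp only at hB
    linarith
  have hF2 : IntervalIntegrable (fun x => F x ^ 2) volume a b :=
    ContinuousOn.intervalIntegrable (by rw [uIcc_of_le hab]; fun_prop)
  have h0 : 0 ≤ ∫ x in a..b, (g x - p x * F x) ^ 2 :=
    intervalIntegral.integral_nonneg hab fun t _ => sq_nonneg _
  have h1 : ∫ x in a..b, (g x - p x * F x) ^ 2 = (∫ x in a..b, g x ^ 2) -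
      (∫ x in a..b, (g x * F x + F x * g x) * p x + F x * F x * (-ω ^ 2 - p x ^ 2)) -
      ω ^ 2 * ∫ x in a..b, F x ^ 2 := by
    rw [← intervalIntegral.integral_const_mul, ← intervalIntegral.integral_sub hg hprod.1,
      ← intervalIntegral.integral_sub (hg.sub hprod.1) (hF2.const_mul _)]
    exact intervalIntegral.integral_congr fun x _ => by ring
  rw [h1, hzero] at h0
  linarith

end IsPrimitiveOn

/-! ### Weak derivatives on an interval -/

/-- A compact subset of an open interval lies in a compact interval inside it. -/
theorem IsCompact.exists_subset_Icc_of_subset_Ioo {K : Set ℝ} (hK : IsCompact K) {a b : ℝ}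
    (hab : a < b) (h : K ⊆ Ioo a b) : ∃ α β, a < α ∧ α ≤ β ∧ β < b ∧ K ⊆ Icc α β := by
  have hK' : IsCompact (insert ((a + b) / 2) K) := hK.insert _
  have hne : (insert ((a + b) / 2) K).Nonempty := insert_nonempty _ _
  have hsub : insert ((a + b) / 2) K ⊆ Ioo a b :=
    insert_subset ⟨by linarith, by linarith⟩ h
  obtain ⟨α, hα, hα'⟩ := hK'.exists_isLeast hne
  obtain ⟨β, hβ, hβ'⟩ := hK'.exists_isGreatest hne
  exact ⟨α, β, (hsub hα).1, hα' hβ, (hsub hβ).2,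
    fun x hx => ⟨hα' (mem_insert_of_mem _ hx), hβ' (mem_insert_of_mem _ hx)⟩⟩

theorem intervalIntegral_eq_integral_of_tsupport_subset_Ioo {φ : ℝ → ℝ} {a b : ℝ}
    (h : tsupport φ ⊆ Ioo a b) : ∫ x in a..b, φ x = ∫ x, φ x :=
  intervalIntegral.integral_eq_integral_of_support_subset
    ((subset_tsupport φ).trans (h.trans Ioo_subset_Ioc_self))

/-- A test function with vanishing integral is the derivative of a test function. -/
theorem exists_deriv_eq_of_integral_eq_zero {θ : ℝ → ℝ} {a b : ℝ} (hab : a < b)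
    (hθ : ContDiff ℝ ((⊤ : ℕ∞) : WithTop ℕ∞) θ) (hc : HasCompactSupport θ)
    (hs : tsupport θ ⊆ Ioo a b) (h0 : ∫ x, θ x = 0) :
    ∃ φ : ℝ → ℝ, ContDiff ℝ ((⊤ : ℕ∞) : WithTop ℕ∞) φ ∧ HasCompactSupport φ ∧
      tsupport φ ⊆ Ioo a b ∧ deriv φ = θ := by
  obtain ⟨α, β, haα, hαβ, hβb, hsub⟩ := IsCompact.exists_subset_Icc_of_subset_Ioo hc hab hs
  have hout : ∀ x, x ∉ Icc α β → θ x = 0 := fun x hx =>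
    image_eq_zero_of_notMem_tsupport fun h => hx (hsub h)
  have hθc : Continuous θ := hθ.continuous
  have hd : ∀ x, HasDerivAt (fun x => ∫ t in a..x, θ t) (θ x) x := fun x =>
    intervalIntegral.integral_hasDerivAt_right (hθc.intervalIntegrable _ _)
      (hθc.stronglyMeasurableAtFilter _ _) hθc.continuousAt
  have hderiv : deriv (fun x => ∫ t in a..x, θ t) = θ := funext fun x => (hd x).deriv
  have hzero : ∀ x, x ∉ Icc α β → ∫ t in a..x, θ t = 0 := by
    intro x hx
    rw [mem_Icc, not_and_or, not_le, not_le] at hx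
    rcases hx with hx | hx
    · have : ∫ t in a..x, θ t = ∫ t in a..x, (0 : ℝ) := by
        refine intervalIntegral.integral_congr fun t ht => hout t fun h => ?_
        have h2 : t ≤ max a x := ht.2
        rcases le_max_iff.1 h2 with h3 | h3
        · exact absurd h.1 (not_le.2 (h3.trans_lt haα))
        · exact absurd h.1 (not_le.2 (h3.trans_lt hx))
      simpa using this
    · rw [← h0]
      refine intervalIntegral.integral_eq_integral_of_support_subset fun t ht => ?_
      by_contra hcon
      refine ht (hout t fun h => hcon ⟨haα.trans_le h.1, h.2.trans hx.le⟩)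
  have htsub : tsupport (fun x => ∫ t in a..x, θ t) ⊆ Icc α β :=
    closure_minimal (fun x hx => by_contra fun h => hx (hzero x h)) isClosed_Icc
  refine ⟨fun x => ∫ t in a..x, θ t, ?_, ?_, ?_, hderiv⟩
  · rw [contDiff_infty_iff_deriv, hderiv]
    exact ⟨fun x => (hd x).differentiableAt, hθ⟩
  · exact isCompact_Icc.of_isClosed_subset (isClosed_tsupport _) htsub
  · exact htsub.trans (Icc_subset_Ioo haα hβb)

/-- The lemma of du Bois-Reymond. -/
theorem exists_eqOn_const_of_integral_mul_deriv_eq_zero {F : ℝ → ℝ} {a b : ℝ} (hab : a < b)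
    (hF : ContinuousOn F (Icc a b))
    (h : ∀ φ : ℝ → ℝ, ContDiff ℝ ((⊤ : ℕ∞) : WithTop ℕ∞) φ → HasCompactSupport φ →
      tsupport φ ⊆ Ioo a b → ∫ x in a..b, F x * deriv φ x = 0) :
    ∃ C, ∀ x ∈ Icc a b, F x = C := by
  -- a test function `ψ` of integral one, by which others are corrected to have integral zero
  obtain ⟨ψ, hψ, hψc, hψs, hψ1⟩ : ∃ ψ : ℝ → ℝ, ContDiff ℝ ((⊤ : ℕ∞) : WithTop ℕ∞) ψ ∧
      HasCompactSupport ψ ∧ tsupport ψ ⊆ Ioo a b ∧ ∫ x, ψ x = 1 := by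
    let B : ContDiffBump ((a + b) / 2) :=
      ⟨(b - a) / 8, (b - a) / 4, by linarith, by linarith⟩
    refine ⟨B.normed volume, B.contDiff_normed, B.hasCompactSupport_normed, ?_, B.integral_normed⟩
    rw [B.tsupport_normed_eq, Real.closedBall_eq_Icc]
    exact Icc_subset_Ioo (by change a < (a + b) / 2 - (b - a) / 4; linarith)
      (by change (a + b) / 2 + (b - a) / 4 < b; linarith)
  have hint : ∀ η : ℝ → ℝ, Continuous η → IntervalIntegrable (fun x => F x * η x) volume a b :=
    fun η hη => ContinuousOn.intervalIntegrable (by rw [uIcc_of_le hab.le]; fun_prop)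
  set C : ℝ := ∫ x in a..b, F x * ψ x with hC
  have key : ∀ η : ℝ → ℝ, ContDiff ℝ ((⊤ : ℕ∞) : WithTop ℕ∞) η → HasCompactSupport η →
      tsupport η ⊆ Ioo a b → ∫ x, η x • (F x - C) = 0 := by
    intro η hη hηc hηs
    set I : ℝ := ∫ x, η x with hI
    have hIψ : HasCompactSupport (fun x => I * ψ x) := hψc.mul_left
    have hθs : tsupport (fun x => η x - I * ψ x) ⊆ Ioo a b := by
      refine (tsupport_sub η (fun x => I * ψ x)).trans (union_subset hηs ?_)
      exact (tsupport_mul_subset_right).trans hψs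
    have hθc : HasCompactSupport (fun x => η x - I * ψ x) := hηc.sub hIψ
    have hθ0 : ∫ x, (η x - I * ψ x) = 0 := by
      rw [integral_sub (hη.continuous.integrable_of_hasCompactSupport hηc)
        ((hψ.continuous.integrable_of_hasCompactSupport hψc).const_mul I),
        integral_const_mul, hψ1]
      simp [hI]
    obtain ⟨φ, hφ, hφc, hφs, hφd⟩ := exists_deriv_eq_of_integral_eq_zero hab
      (hη.sub (contDiff_const.mul hψ)) hθc hθs hθ0
    have h1 := h φ hφ hφc hφs
    rw [hφd] at h1
    have hIab : I = ∫ x in a..b, η x :=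
      (intervalIntegral_eq_integral_of_tsupport_subset_Ioo hηs).symm
    have h2 : ∫ x, η x • (F x - C) = ∫ x in a..b, η x • (F x - C) := by
      refine (intervalIntegral_eq_integral_of_tsupport_subset_Ioo ?_).symm
      exact (tsupport_smul_subset_left η _).trans hηs
    rw [h2]
    have h3 : ∫ x in a..b, F x * (η x - I * ψ x)
        = (∫ x in a..b, F x * η x) - I * C := by
      rw [hC, ← intervalIntegral.integral_const_mul, ← intervalIntegral.integral_sub
        (hint _ hη.continuous) ((hint _ hψ.continuous).const_mul _)]
      exact intervalIntegral.integral_congr fun x _ => by ring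
    have h4 : ∫ x in a..b, η x • (F x - C) = (∫ x in a..b, F x * η x) - I * C := by
      rw [hIab, mul_comm, ← intervalIntegral.integral_const_mul, ← intervalIntegral.integral_sub
        (hint _ hη.continuous) ((hη.continuous.intervalIntegrable _ _).const_mul _)]
      exact intervalIntegral.integral_congr fun x _ => by simp only [smul_eq_mul]; ring
    rw [h4, ← h3]
    exact h1
  have hFC : ContinuousOn (fun x => F x - C) (Icc a b) := hF.sub continuousOn_const
  have hae := isOpen_Ioo.ae_eq_zero_of_integral_contDiff_smul_eq_zero
    ((hFC.mono Ioo_subset_Icc_self).locallyIntegrableOn measurableSet_Ioo) key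
  refine ⟨C, fun x hx => ?_⟩
  have hE : EqOn (fun x => F x - C) (fun _ => 0) (Icc a b) := by
    refine Measure.eqOn_Icc_of_ae_eq volume hab.ne ?_ hFC continuousOn_const
    rw [← restrict_Ioo_eq_restrict_Icc, Filter.EventuallyEq, ae_restrict_iff' measurableSet_Ioo]
    exact hae
  exact sub_eq_zero.1 (hE hx)

/-- On an interval, a continuous function has the integrable function `g` as its weak derivative
iff it is a primitive of `g`. -/
theorem isPrimitiveOn_iff_weakDeriv {F g : ℝ → ℝ} {b : ℝ} (hb : 0 < b)
    (hF : ContinuousOn F (Icc 0 b)) (hg : IntervalIntegrable g volume 0 b) :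
    IsPrimitiveOn F g 0 b ↔ ∀ φ : ℝ → ℝ, ContDiff ℝ ((⊤ : ℕ∞) : WithTop ℕ∞) φ →
      HasCompactSupport φ → tsupport φ ⊆ Ioo 0 b →
      ∫ x in (0 : ℝ)..b, g x * φ x = -∫ x in (0 : ℝ)..b, F x * deriv φ x := by
  have parts : ∀ {G : ℝ → ℝ}, IsPrimitiveOn G g 0 b → ∀ φ : ℝ → ℝ,
      ContDiff ℝ ((⊤ : ℕ∞) : WithTop ℕ∞) φ → tsupport φ ⊆ Ioo 0 b →
      ∫ x in (0 : ℝ)..b, g x * φ x = -∫ x in (0 : ℝ)..b, G x * deriv φ x := by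
    intro G hG φ hφ hs
    have hφ' : Continuous (deriv φ) := hφ.continuous_deriv (by simp)
    have hφP : IsPrimitiveOn φ (deriv φ) 0 b := IsPrimitiveOn.of_hasDerivAt hb.le
      (fun x _ => (hφ.differentiable (by simp) x).hasDerivAt) hφ'.continuousOn
    have h := (hG.mul hφP hb.le).2 b ⟨hb.le, le_rfl⟩
    have h1 : φ 0 = 0 := image_eq_zero_of_notMem_tsupport fun h => lt_irrefl _ (hs h).1
    have h2 : φ b = 0 := image_eq_zero_of_notMem_tsupport fun h => lt_irrefl _ (hs h).2
    have hGc := hG.continuousOn hb.le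
    rw [intervalIntegral.integral_add
      (hG.intervalIntegrable_mul hφ.continuous.continuousOn hb.le)
      (ContinuousOn.intervalIntegrable (by rw [uIcc_of_le hb.le]; fun_prop))] at h
    simp only [h1, h2] at h
    linarith
  refine ⟨fun h φ hφ _ hs => parts h φ hφ hs, fun h => ⟨hg, ?_⟩⟩
  have hP : IsPrimitiveOn (fun x => ∫ t in (0 : ℝ)..x, g t) g 0 b :=
    ⟨hg, fun x _ => by simp⟩
  have hPc := hP.continuousOn hb.le
  obtain ⟨C, hC⟩ := exists_eqOn_const_of_integral_mul_deriv_eq_zero hb (hF.sub hPc) (by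
    intro φ hφ hc hs
    have hφ' : Continuous (deriv φ) := hφ.continuous_deriv (by simp)
    have h1 := h φ hφ hc hs
    have h2 := parts hP φ hφ hs
    have : ∀ x, (F - fun x => ∫ t in (0 : ℝ)..x, g t) x * deriv φ x
        = F x * deriv φ x - (∫ t in (0 : ℝ)..x, g t) * deriv φ x := fun x => by
      simp [sub_mul]
    simp_rw [this]
    rw [intervalIntegral.integral_sub
      (ContinuousOn.intervalIntegrable (by rw [uIcc_of_le hb.le]; fun_prop))
      (ContinuousOn.intervalIntegrable (by rw [uIcc_of_le hb.le]; fun_prop))]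
    linarith)
  intro x hx
  have h1 := hC x hx
  have h2 := hC 0 ⟨le_rfl, hb.le⟩
  simp at h1 h2
  linarith

/-! ### The spaces `L²(Γ)` and `H¹(Γ)` -/

namespace CompactMetricGraph

variable {Γ : CompactMetricGraph}

theorem MemL2.intervalIntegrable_mul {g h : Γ.EdgeFun} (hg : MemL2 g) (hh : MemL2 h)
    (k : Fin Γ.numEdges) : IntervalIntegrable (fun x => g k x * h k x) volume 0 (Γ.len k) := by
  rw [intervalIntegrable_iff_integrableOn_Ioo_of_le (Γ.len_pos k).le]
  exact (hg k).integrable_mul (hh k)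

theorem MemL2.intervalIntegrable_sq {g : Γ.EdgeFun} (hg : MemL2 g) (k : Fin Γ.numEdges) :
    IntervalIntegrable (fun x => g k x ^ 2) volume 0 (Γ.len k) := by
  simpa only [sq] using hg.intervalIntegrable_mul hg k

theorem MemL2.intervalIntegrable {g : Γ.EdgeFun} (hg : MemL2 g) (k : Fin Γ.numEdges) :
    IntervalIntegrable (g k) volume 0 (Γ.len k) := by
  rw [intervalIntegrable_iff_integrableOn_Ioo_of_le (Γ.len_pos k).le]
  exact (hg k).integrable (by norm_num)

theorem MemL2.linear_comb {g h : Γ.EdgeFun} (hg : MemL2 g) (hh : MemL2 h) (a b : ℝ) :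
    MemL2 (a • g + b • h) := fun k => ((hg k).const_smul a).add ((hh k).const_smul b)

theorem memL2_of_continuousOn {g : Γ.EdgeFun}
    (hg : ∀ k, ContinuousOn (g k) (Icc 0 (Γ.len k))) : MemL2 g := fun k => by
  refine MemLp.mono_measure (Measure.restrict_mono Ioo_subset_Icc_self le_rfl) ?_
  rw [memLp_two_iff_integrable_sq ((hg k).aestronglyMeasurable measurableSet_Icc)]
  exact ((hg k).pow 2).integrableOn_compact isCompact_Icc

theorem innerL2_comm (g h : Γ.EdgeFun) : innerL2 g h = innerL2 h g := by
  simp only [innerL2, mul_comm]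

theorem innerL2_self (g : Γ.EdgeFun) :
    innerL2 g g = ∑ k, ∫ x in (0 : ℝ)..(Γ.len k), g k x ^ 2 := by
  simp only [innerL2, sq]

theorem integral_sq_nonneg (g : Γ.EdgeFun) (k : Fin Γ.numEdges) :
    0 ≤ ∫ x in (0 : ℝ)..(Γ.len k), g k x ^ 2 :=
  intervalIntegral.integral_nonneg (Γ.len_pos k).le fun _ _ => sq_nonneg _

theorem innerL2_self_nonneg (g : Γ.EdgeFun) : 0 ≤ innerL2 g g := by
  rw [innerL2_self]
  exact Finset.sum_nonneg fun k _ => integral_sq_nonneg g k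

theorem integral_sq_le_innerL2 (g : Γ.EdgeFun) (k : Fin Γ.numEdges) :
    ∫ x in (0 : ℝ)..(Γ.len k), g k x ^ 2 ≤ innerL2 g g := by
  rw [innerL2_self]
  exact Finset.single_le_sum (f := fun k => ∫ x in (0 : ℝ)..(Γ.len k), g k x ^ 2)
    (fun k _ => integral_sq_nonneg g k) (Finset.mem_univ k)

theorem innerL2_linear_comb_left {g h u : Γ.EdgeFun} (hg : MemL2 g) (hh : MemL2 h) (hu : MemL2 u)
    (a b : ℝ) : innerL2 (a • g + b • h) u = a * innerL2 g u + b * innerL2 h u := by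
  simp only [innerL2, Finset.mul_sum, ← Finset.sum_add_distrib]
  refine Finset.sum_congr rfl fun k _ => ?_
  rw [← intervalIntegral.integral_const_mul, ← intervalIntegral.integral_const_mul,
    ← intervalIntegral.integral_add ((hg.intervalIntegrable_mul hu k).const_mul a)
      ((hh.intervalIntegrable_mul hu k).const_mul b)]
  refine intervalIntegral.integral_congr fun x _ => ?_
  simp only [Pi.add_apply, Pi.smul_apply, smul_eq_mul]
  ring

theorem innerL2_smul_left (a : ℝ) (g u : Γ.EdgeFun) :
    innerL2 (a • g) u = a * innerL2 g u := by
  simp only [innerL2, Finset.mul_sum, ← intervalIntegral.integral_const_mul, Pi.smul_apply,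
    smul_eq_mul, mul_assoc]

theorem innerL2_linear_comb_self {g h : Γ.EdgeFun} (hg : MemL2 g) (hh : MemL2 h) (a b : ℝ) :
    innerL2 (a • g + b • h) (a • g + b • h)
      = a ^ 2 * innerL2 g g + 2 * a * b * innerL2 g h + b ^ 2 * innerL2 h h := by
  rw [innerL2_linear_comb_left hg hh (hg.linear_comb hh a b), innerL2_comm g,
    innerL2_comm h (a • g + b • h), innerL2_linear_comb_left hg hh hg,
    innerL2_linear_comb_left hg hh hh, innerL2_comm h g]
  ring

theorem continuous_pt (k : Fin Γ.numEdges) : Continuous (Γ.pt k) :=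
  continuous_quot_mk.comp continuous_sigmaMk

theorem onEdges_apply (f : Γ.Point → ℝ) {k : Fin Γ.numEdges} {x : ℝ}
    (hx : x ∈ Icc 0 (Γ.len k)) : onEdges f k x = f (Γ.pt k ⟨x, hx⟩) :=
  IccExtend_of_mem _ _ hx

theorem continuous_onEdges {f : Γ.Point → ℝ} (hf : Continuous f) (k : Fin Γ.numEdges) :
    Continuous (onEdges f k) := (hf.comp (continuous_pt k)).Icc_extend'

theorem memL2_onEdges {f : Γ.Point → ℝ} (hf : Continuous f) : MemL2 (onEdges f) :=
  memL2_of_continuousOn fun k => (continuous_onEdges hf k).continuousOn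

theorem onEdges_linear_comb (a b : ℝ) (f g : Γ.Point → ℝ) :
    onEdges (a • f + b • g) = a • onEdges f + b • onEdges g := rfl

theorem onEdges_smul (a : ℝ) (f : Γ.Point → ℝ) : onEdges (a • f) = a • onEdges f := rfl

theorem onEdges_one : onEdges (1 : Γ.Point → ℝ) = 1 := rfl

theorem memL2_one : MemL2 (1 : Γ.EdgeFun) := memL2_onEdges (f := 1) continuous_const

/-- Functions in `H¹(Γ)` are the continuous functions that are, on every edge, primitives of a
square integrable function. -/
theorem hasH1Deriv_iff {f : Γ.Point → ℝ} {f' : Γ.EdgeFun} : HasH1Deriv f f' ↔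
    Continuous f ∧ MemL2 f' ∧ ∀ k, IsPrimitiveOn (onEdges f k) (f' k) 0 (Γ.len k) := by
  refine and_congr_right fun hf => and_congr_right fun hf' => forall_congr' fun k => ?_
  exact (isPrimitiveOn_iff_weakDeriv (Γ.len_pos k) (continuous_onEdges hf k).continuousOn
    (hf'.intervalIntegrable k)).symm

theorem HasH1Deriv.isPrimitiveOn {f : Γ.Point → ℝ} {f' : Γ.EdgeFun} (h : HasH1Deriv f f')
    (k : Fin Γ.numEdges) : IsPrimitiveOn (onEdges f k) (f' k) 0 (Γ.len k) :=
  (hasH1Deriv_iff.1 h).2.2 k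

theorem HasH1Deriv.memL2 {f : Γ.Point → ℝ} {f' : Γ.EdgeFun} (h : HasH1Deriv f f') :
    MemL2 (onEdges f) := memL2_onEdges h.1

theorem HasH1Deriv.linear_comb {f g : Γ.Point → ℝ} {f' g' : Γ.EdgeFun} (hf : HasH1Deriv f f')
    (hg : HasH1Deriv g g') (a b : ℝ) : HasH1Deriv (a • f + b • g) (a • f' + b • g') :=
  hasH1Deriv_iff.2 ⟨(hf.1.const_smul a).add (hg.1.const_smul b), hf.2.1.linear_comb hg.2.1 a b,
    fun k => ((hf.isPrimitiveOn k).const_mul a).add ((hg.isPrimitiveOn k).const_mul b)⟩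

theorem hasH1Deriv_one : HasH1Deriv (1 : Γ.Point → ℝ) 0 :=
  hasH1Deriv_iff.2 ⟨continuous_const, fun _ => MemLp.zero, fun k =>
    ⟨by simp [Pi.zero_def], fun x _ => by simp [onEdges_one]⟩⟩

/-- The function on the graph given by functions on the edges that agree at each vertex. -/
def ofEdges (F : Γ.EdgeFun)
    (h : ∀ s t, Γ.glue s t → F s.1 (Γ.endpoint s).2 = F t.1 (Γ.endpoint t).2) : Γ.Point → ℝ :=
  Quotient.lift (fun p : Γ.PrePoint => F p.1 p.2) (by
    rintro p q (rfl | ⟨s, t, hst, rfl, rfl⟩)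
    · rfl
    · exact h s t hst)

section ofEdges

variable {F F' : Γ.EdgeFun}
  (h : ∀ s t, Γ.glue s t → F s.1 (Γ.endpoint s).2 = F t.1 (Γ.endpoint t).2)

theorem onEdges_ofEdges {k : Fin Γ.numEdges} {x : ℝ} (hx : x ∈ Icc 0 (Γ.len k)) :
    onEdges (ofEdges F h) k x = F k x := by
  rw [onEdges_apply _ hx]
  rfl

theorem continuous_ofEdges (hF : ∀ k, ContinuousOn (F k) (Icc 0 (Γ.len k))) :
    Continuous (ofEdges F h) := by
  refine Continuous.quotient_lift (continuous_sigma fun k => ?_) _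
  exact continuousOn_iff_continuous_domRestrict.1 (hF k)

theorem hasH1Deriv_ofEdges (hF' : MemL2 F')
    (hF : ∀ k, IsPrimitiveOn (F k) (F' k) 0 (Γ.len k)) : HasH1Deriv (ofEdges F h) F' :=
  hasH1Deriv_iff.2 ⟨continuous_ofEdges h fun k => (hF k).continuousOn (Γ.len_pos k).le, hF',
    fun k => (hF k).congr (fun _ hx => onEdges_ofEdges h hx) (Γ.len_pos k).le⟩

end ofEdges

theorem eq_zero_of_innerL2_self_eq_zero {f : Γ.Point → ℝ} (hf : Continuous f)
    (h : innerL2 (onEdges f) (onEdges f) = 0) : f = 0 := by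
  rw [innerL2_self, Finset.sum_eq_zero_iff_of_nonneg fun k _ => integral_sq_nonneg _ k] at h
  funext p
  induction p using Quotient.inductionOn with
  | h p =>
  obtain ⟨k, x, hx⟩ := p
  have hk := h k (Finset.mem_univ k)
  have hc := continuous_onEdges hf k
  by_contra hne
  have : onEdges f k x ≠ 0 := by rw [onEdges_apply f hx]; exact hne
  refine absurd hk (ne_of_gt ?_)
  exact intervalIntegral.integral_pos (Γ.len_pos k) (by fun_prop) (fun _ _ => sq_nonneg _)
    ⟨x, hx, by positivity⟩

theorem innerL2_self_pos {f : Γ.Point → ℝ} (hf : Continuous f) (h : f ≠ 0) :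
    0 < innerL2 (onEdges f) (onEdges f) :=
  lt_of_le_of_ne (innerL2_self_nonneg _) fun h0 => h (eq_zero_of_innerL2_self_eq_zero hf h0.symm)

theorem innerL2_one_one : innerL2 (1 : Γ.EdgeFun) 1 = Γ.totalLength := by
  simp [innerL2, totalLength]

/-- A function in `H¹(Γ)` minus its mean has mean zero. -/
theorem innerL2_sub_mean_one {f : Γ.Point → ℝ} (hf : Continuous f) (hL : 0 < Γ.totalLength) :
    innerL2 (onEdges ((1 : ℝ) • f + (-(innerL2 (onEdges f) 1 / Γ.totalLength)) • 1)) 1 = 0 := by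
  rw [onEdges_linear_comb, onEdges_one,
    innerL2_linear_comb_left (memL2_onEdges hf) memL2_one memL2_one,
    innerL2_one_one]
  field_simp
  ring

/-! ### Compactness of the embedding of `H¹(Γ)` into the continuous functions -/

/-- The embedding of `H¹(Γ)` into the space of bounded functions is bounded. -/
theorem HasH1Deriv.exists_sq_le (Γ : CompactMetricGraph) (C : ℝ) : ∃ M, ∀ (f : Γ.Point → ℝ) f',
    HasH1Deriv f f' → innerL2 f' f' ≤ C → innerL2 (onEdges f) (onEdges f) ≤ C →
    ∀ k, ∀ x ∈ Icc 0 (Γ.len k), onEdges f k x ^ 2 ≤ M := by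
  refine ⟨∑ k, (2 * |C| / Γ.len k + 2 * Γ.len k * |C|), fun f f' h hq hn k x hx => ?_⟩
  have hl := Γ.len_pos k
  have hterm : ∀ k, 0 ≤ 2 * |C| / Γ.len k + 2 * Γ.len k * |C| := fun k => by
    have := Γ.len_pos k; positivity
  refine le_trans ?_ (Finset.single_le_sum (fun k _ => hterm k) (Finset.mem_univ k))
  have hc := continuous_onEdges h.1 k
  have hq' : ∫ t in (0 : ℝ)..(Γ.len k), f' k t ^ 2 ≤ |C| :=
    (integral_sq_le_innerL2 f' k).trans (hq.trans (le_abs_self C))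
  have hn' : ∫ t in (0 : ℝ)..(Γ.len k), onEdges f k t ^ 2 ≤ |C| :=
    (integral_sq_le_innerL2 _ k).trans (hn.trans (le_abs_self C))
  have hpt : ∀ y ∈ Icc 0 (Γ.len k), onEdges f k x ^ 2
      ≤ 2 * onEdges f k y ^ 2 + 2 * (Γ.len k * |C|) := by
    intro y hy
    have h1 := (h.isPrimitiveOn k).sq_sub_le (h.2.1.intervalIntegrable_sq k) hx hy
    have h2 : |x - y| ≤ Γ.len k := by
      rw [abs_le]; constructor <;> linarith [hx.1, hx.2, hy.1, hy.2]
    have h3 : |x - y| * ∫ t in (0 : ℝ)..(Γ.len k), f' k t ^ 2 ≤ Γ.len k * |C| :=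
      mul_le_mul h2 hq' (integral_sq_nonneg f' k) hl.le
    nlinarith [sq_nonneg (onEdges f k x - 2 * onEdges f k y)]
  have hint := intervalIntegral.integral_mono_on hl.le (μ := volume)
    (f := fun _ => onEdges f k x ^ 2)
    (g := fun y => 2 * onEdges f k y ^ 2 + 2 * (Γ.len k * |C|)) (by simp)
    (Continuous.intervalIntegrable (by fun_prop) _ _) hpt
  rw [intervalIntegral.integral_add (Continuous.intervalIntegrable (by fun_prop) _ _) (by simp),
    intervalIntegral.integral_const_mul] at hint
  simp only [intervalIntegral.integral_const, smul_eq_mul, sub_zero] at hint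
  have : Γ.len k * onEdges f k x ^ 2
      ≤ Γ.len k * (2 * |C| / Γ.len k + 2 * Γ.len k * |C|) := by
    rw [mul_add, mul_div_cancel₀ _ hl.ne']
    linarith
  exact le_of_mul_le_mul_left this hl

/-- A sequence that is bounded in `H¹(Γ)` has a subsequence that converges uniformly to a
continuous function. -/
theorem HasH1Deriv.exists_subseq_tendsto {f : ℕ → Γ.Point → ℝ} {f' : ℕ → Γ.EdgeFun}
    (h : ∀ n, HasH1Deriv (f n) (f' n)) {C : ℝ} (hq : ∀ n, innerL2 (f' n) (f' n) ≤ C)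
    (hn : ∀ n, innerL2 (onEdges (f n)) (onEdges (f n)) ≤ C) :
    ∃ (u : Γ.Point → ℝ) (φ : ℕ → ℕ), Continuous u ∧ StrictMono φ ∧
      TendstoUniformly (fun n => f (φ n)) u Filter.atTop := by
  obtain ⟨M, hM⟩ := HasH1Deriv.exists_sq_le Γ C
  -- compositions with the quotient map, on the compact disjoint union of the edges
  let G : ℕ → BoundedContinuousFunction Γ.PrePoint ℝ := fun n =>
    BoundedContinuousFunction.mkOfCompact ⟨fun p => f n (Quotient.mk Γ.pointSetoid p),
      (h n).1.comp continuous_quot_mk⟩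
  have hG : ∀ n k (x : Icc (0 : ℝ) (Γ.len k)), G n ⟨k, x⟩ = onEdges (f n) k x := by
    intro n k x
    rw [onEdges_apply _ x.2]
    rfl
  have hcomp : IsCompact (closure (range G)) := by
    refine BoundedContinuousFunction.arzela_ascoli (Icc (-Real.sqrt M) (Real.sqrt M))
      isCompact_Icc _ ?_ ?_
    · rintro _ ⟨k, x⟩ ⟨n, rfl⟩
      rw [hG, mem_Icc, ← abs_le]
      exact Real.abs_le_sqrt (hM _ _ (h n) (hq n) (hn n) k x x.2)
    · rintro ⟨k, x⟩
      rw [Metric.equicontinuousAt_iff_right]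
      intro ε hε
      have hcont : Filter.Tendsto (fun y : Icc (0 : ℝ) (Γ.len k) => |(x : ℝ) - y| * |C|)
          (nhds x) (nhds 0) := by
        have : Continuous fun y : Icc (0 : ℝ) (Γ.len k) => |(x : ℝ) - y| * |C| := by fun_prop
        simpa using this.tendsto x
      rw [Sigma.nhds_mk, Filter.eventually_map]
      filter_upwards [hcont.eventually (gt_mem_nhds (pow_pos hε 2))] with y hy
      rintro ⟨_, n, rfl⟩
      simp only [hG]
      rw [Real.dist_eq]
      refine abs_lt_of_sq_lt_sq ?_ hε.le
      refine lt_of_le_of_lt (((h n).isPrimitiveOn k).sq_sub_le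
        ((h n).2.1.intervalIntegrable_sq k) x.2 y.2) (lt_of_le_of_lt ?_ hy)
      exact mul_le_mul_of_nonneg_left
        ((integral_sq_le_innerL2 (f' n) k).trans ((hq n).trans (le_abs_self C))) (abs_nonneg _)
  obtain ⟨g, -, φ, hφ, hlim⟩ := hcomp.tendsto_subseq fun n => subset_closure (mem_range_self n)
  rw [BoundedContinuousFunction.tendsto_iff_tendstoUniformly] at hlim
  have hpt : ∀ p, Filter.Tendsto (fun n => f (φ n) (Quotient.mk Γ.pointSetoid p)) Filter.atTop
      (nhds (g p)) := fun p => hlim.tendsto_at p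
  refine ⟨Quotient.lift g fun p q hpq => ?_, φ, g.continuous.quotient_lift _, hφ, ?_⟩
  · have : Quotient.mk Γ.pointSetoid p = Quotient.mk Γ.pointSetoid q := Quotient.sound hpq
    have h1 := hpt p
    rw [this] at h1
    exact tendsto_nhds_unique h1 (hpt q)
  · refine Metric.tendstoUniformly_iff.2 fun ε hε => ?_
    rw [Metric.tendstoUniformly_iff] at hlim
    filter_upwards [hlim ε hε] with n hn' p
    induction p using Quotient.inductionOn with
    | h p => exact hn' p

/-! ### Existence of a minimizer of the Rayleigh quotient -/

theorem MemL2.sub {g h : Γ.EdgeFun} (hg : MemL2 g) (hh : MemL2 h) : MemL2 (g - h) :=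
  fun k => (hg k).sub (hh k)

theorem innerL2_sub_self {g h : Γ.EdgeFun} (hg : MemL2 g) (hh : MemL2 h) :
    innerL2 (g - h) (g - h) = innerL2 g g - 2 * innerL2 g h + innerL2 h h := by
  have h1 := innerL2_linear_comb_self hg hh 1 (-1)
  rw [one_smul, neg_one_smul, ← sub_eq_add_neg] at h1
  linarith

theorem innerL2_add_self {g h : Γ.EdgeFun} (hg : MemL2 g) (hh : MemL2 h) :
    innerL2 (g + h) (g + h) = innerL2 g g + 2 * innerL2 g h + innerL2 h h := by
  have h1 := innerL2_linear_comb_self hg hh 1 1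
  rw [one_smul, one_smul] at h1
  linarith

theorem innerL2_sub_self_le {g h u : Γ.EdgeFun} (hg : MemL2 g) (hh : MemL2 h) (hu : MemL2 u) :
    innerL2 (g - h) (g - h)
      ≤ 2 * innerL2 (g - u) (g - u) + 2 * innerL2 (h - u) (h - u) := by
  have h1 := innerL2_sub_self (hg.sub hu) (hh.sub hu)
  have h2 := innerL2_add_self (hg.sub hu) (hh.sub hu)
  rw [sub_sub_sub_cancel_right] at h1
  have h3 := innerL2_self_nonneg (g - u + (h - u))
  linarith

theorem MemL2.norm_sq_toLp {g : Γ.EdgeFun} (hg : MemL2 g) (k : Fin Γ.numEdges) :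
    ‖(hg k).toLp (g k)‖ ^ 2 = ∫ x in (0 : ℝ)..(Γ.len k), g k x ^ 2 := by
  rw [← real_inner_self_eq_norm_sq, L2.inner_def,
    intervalIntegral.integral_of_le (Γ.len_pos k).le, integral_Ioc_eq_integral_Ioo]
  refine integral_congr_ae ?_
  filter_upwards [(hg k).coeFn_toLp] with x hx
  simp [hx, sq]

theorem innerL2_one_linear_comb {f g : Γ.Point → ℝ} (hf : Continuous f) (hg : Continuous g)
    (a b : ℝ) : innerL2 (onEdges (a • f + b • g)) 1
      = a * innerL2 (onEdges f) 1 + b * innerL2 (onEdges g) 1 :=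
  innerL2_linear_comb_left (memL2_onEdges hf) (memL2_onEdges hg)
    memL2_one a b

/-- Completeness of `L²(Γ)`. -/
theorem exists_tendsto_of_cauchy {g : ℕ → Γ.EdgeFun} (hg : ∀ n, MemL2 (g n))
    (hc : ∀ ε > 0, ∃ N, ∀ m ≥ N, ∀ n ≥ N, innerL2 (g m - g n) (g m - g n) < ε) :
    ∃ u : Γ.EdgeFun, MemL2 u ∧
      Filter.Tendsto (fun n => innerL2 (g n - u) (g n - u)) Filter.atTop (nhds 0) ∧
      Filter.Tendsto (fun n => innerL2 (g n) (g n)) Filter.atTop (nhds (innerL2 u u)) := by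
  have hlim : ∀ k, ∃ G, Filter.Tendsto (fun n => (hg n k).toLp (g n k)) Filter.atTop (nhds G) := by
    intro k
    refine cauchySeq_tendsto_of_complete (Metric.cauchySeq_iff.2 fun ε hε => ?_)
    obtain ⟨N, hN⟩ := hc (ε ^ 2) (pow_pos hε 2)
    refine ⟨N, fun m hm n hn => ?_⟩
    rw [dist_eq_norm, ← MemLp.toLp_sub]
    refine lt_of_pow_lt_pow_left₀ 2 hε.le ?_
    exact (((hg m).sub (hg n)).norm_sq_toLp k).trans_lt
      ((integral_sq_le_innerL2 _ k).trans_lt (hN m hm n hn))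
  choose G hG using hlim
  have hu : MemL2 (fun k => G k : Γ.EdgeFun) := fun k => Lp.memLp (G k)
  have huG : ∀ k, (hu k).toLp (G k) = G k := fun k => Lp.toLp_coeFn _ _
  refine ⟨fun k => G k, hu, ?_, ?_⟩
  · simp only [innerL2_self]
    rw [show nhds (0 : ℝ) = nhds (∑ _k : Fin Γ.numEdges, (0 : ℝ)) by simp]
    refine tendsto_finsetSum _ fun k _ => ?_
    have h1 : Filter.Tendsto (fun n => ‖(hg n k).toLp (g n k) - G k‖ ^ 2) Filter.atTop
        (nhds 0) := by
      have := ((hG k).sub_const (G k)).norm.pow 2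
      simpa using this
    refine h1.congr fun n => ?_
    rw [← ((hg n).sub hu).norm_sq_toLp k]
    congr 2
    nth_rewrite 1 [← huG k]
    rw [← MemLp.toLp_sub]
    rfl
  · simp only [innerL2_self]
    refine tendsto_finsetSum _ fun k _ => ?_
    rw [← hu.norm_sq_toLp k, huG k]
    exact ((hG k).norm.pow 2).congr fun n => (hg n).norm_sq_toLp k

theorem tendsto_innerL2_of_tendstoUniformly {f g : ℕ → Γ.Point → ℝ} {u v : Γ.Point → ℝ}
    (hf : ∀ n, Continuous (f n)) (hg : ∀ n, Continuous (g n)) (hu : Continuous u)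
    (hv : Continuous v) (hfu : TendstoUniformly f u Filter.atTop)
    (hgv : TendstoUniformly g v Filter.atTop) :
    Filter.Tendsto (fun n => innerL2 (onEdges (f n)) (onEdges (g n))) Filter.atTop
      (nhds (innerL2 (onEdges u) (onEdges v))) := by
  refine tendsto_finsetSum _ fun k _ => ?_
  have bound : ∀ {f : ℕ → Γ.Point → ℝ} {u : Γ.Point → ℝ}, TendstoUniformly f u Filter.atTop →
      ∀ᶠ n in Filter.atTop, ∀ x, |onEdges (f n) k x| ≤ |onEdges u k x| + 1 := by
    intro f u hfu
    filter_upwards [Metric.tendstoUniformly_iff.1 hfu 1 one_pos] with n hn x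
    have h1 : dist (onEdges u k x) (onEdges (f n) k x) < 1 := hn _
    rw [dist_comm, Real.dist_eq] at h1
    have := abs_sub_abs_le_abs_sub (onEdges (f n) k x) (onEdges u k x)
    linarith
  have hcu := continuous_onEdges hu k
  have hcv := continuous_onEdges hv k
  refine intervalIntegral.tendsto_integral_filter_of_dominated_convergence
    (fun x => (|onEdges u k x| + 1) * (|onEdges v k x| + 1)) ?_ ?_ ?_ ?_
  · exact Filter.Eventually.of_forall fun n =>
      ((continuous_onEdges (hf n) k).mul (continuous_onEdges (hg n) k)).aestronglyMeasurable
  · filter_upwards [bound hfu, bound hgv] with n h1 h2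
    refine Filter.Eventually.of_forall fun x _ => ?_
    rw [Real.norm_eq_abs, abs_mul]
    exact mul_le_mul (h1 x) (h2 x) (abs_nonneg _) (by positivity)
  · exact Continuous.intervalIntegrable (by fun_prop) _ _
  · exact Filter.Eventually.of_forall fun x _ => (hfu.tendsto_at _).mul (hgv.tendsto_at _)

/-- The uniform limit of functions in `H¹(Γ)` whose derivatives converge in `L²(Γ)`. -/
theorem hasH1Deriv_of_tendsto {f : ℕ → Γ.Point → ℝ} {f' : ℕ → Γ.EdgeFun} {u : Γ.Point → ℝ}
    {u' : Γ.EdgeFun} (h : ∀ n, HasH1Deriv (f n) (f' n)) (hu : Continuous u) (hu' : MemL2 u')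
    (hfu : TendstoUniformly f u Filter.atTop)
    (hlim : Filter.Tendsto (fun n => innerL2 (f' n - u') (f' n - u')) Filter.atTop (nhds 0)) :
    HasH1Deriv u u' := by
  refine hasH1Deriv_iff.2 ⟨hu, hu', fun k => ⟨hu'.intervalIntegrable k, fun x hx => ?_⟩⟩
  have hl := (Γ.len_pos k).le
  have h0 : (0 : ℝ) ∈ Icc 0 (Γ.len k) := ⟨le_rfl, hl⟩
  -- the primitive of `f' n - u'`
  let D : ℕ → ℝ → ℝ := fun n x => ∫ t in (0 : ℝ)..x, (f' n - u') k t
  have hmem : ∀ n, MemL2 (f' n - u') := fun n => (h n).2.1.sub hu'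
  have hD : ∀ n, IsPrimitiveOn (D n) ((f' n - u') k) 0 (Γ.len k) := fun n =>
    ⟨(hmem n).intervalIntegrable k, fun x _ => by simp [D]⟩
  have hDx : Filter.Tendsto (fun n => D n x) Filter.atTop (nhds 0) := by
    have h1 : Filter.Tendsto (fun n => (D n x) ^ 2) Filter.atTop (nhds 0) := by
      refine squeeze_zero (fun n => sq_nonneg _) (fun n => ?_)
        (g := fun n => |x - 0| * innerL2 (f' n - u') (f' n - u')) ?_
      · have := (hD n).sq_sub_le ((hmem n).intervalIntegrable_sq k) hx h0
        have hz : D n 0 = 0 := by simp [D]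
        rw [hz, sub_zero] at this
        exact this.trans (mul_le_mul_of_nonneg_left (integral_sq_le_innerL2 _ k) (abs_nonneg _))
      · simpa using hlim.const_mul |x - 0|
    have h2 := h1.sqrt
    simp only [Real.sqrt_sq_eq_abs, Real.sqrt_zero] at h2
    exact (tendsto_zero_iff_abs_tendsto_zero _).2 h2
  have hDeq : ∀ n, D n x = onEdges (f n) k x - onEdges (f n) k 0 - ∫ t in (0 : ℝ)..x, u' k t := by
    intro n
    have e := ((h n).isPrimitiveOn k).2 x hx
    have i1 := (((h n).isPrimitiveOn k).mono le_rfl hx.1 hx.2).1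
    have i2 : IntervalIntegrable (u' k) volume 0 x := (hu'.intervalIntegrable k).mono_set
      (by rw [uIcc_of_le hx.1, uIcc_of_le hl]; exact Icc_subset_Icc_right hx.2)
    have e2 : D n x = (∫ t in (0 : ℝ)..x, f' n k t) - ∫ t in (0 : ℝ)..x, u' k t :=
      intervalIntegral.integral_sub i1 i2
    rw [e2]
    linarith
  have hlim2 : Filter.Tendsto (fun n => D n x) Filter.atTop
      (nhds (onEdges u k x - onEdges u k 0 - ∫ t in (0 : ℝ)..x, u' k t)) := by
    simp only [hDeq]
    exact ((hfu.tendsto_at _).sub (hfu.tendsto_at _)).sub_const _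
  have := tendsto_nhds_unique hDx hlim2
  linarith

/-- The Rayleigh quotient `∫ u'² / ∫ u²` attains its infimum `ν` over the nonzero functions in
`H¹(Γ)` with mean zero. A minimizing sequence has a uniformly convergent subsequence, and by the
parallelogram identity its derivatives then form a Cauchy sequence in `L²(Γ)`. -/
theorem exists_rayleigh_minimizer (hne : ∃ (f : Γ.Point → ℝ) (f' : Γ.EdgeFun), HasH1Deriv f f' ∧
      f ≠ 0 ∧ innerL2 (onEdges f) 1 = 0) :
    ∃ (ν : ℝ) (u : Γ.Point → ℝ) (u' : Γ.EdgeFun), HasH1Deriv u u' ∧ u ≠ 0 ∧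
      innerL2 (onEdges u) 1 = 0 ∧ innerL2 u' u' = ν * innerL2 (onEdges u) (onEdges u) ∧
      ∀ (v : Γ.Point → ℝ) (v' : Γ.EdgeFun), HasH1Deriv v v' → innerL2 (onEdges v) 1 = 0 →
        ν * innerL2 (onEdges v) (onEdges v) ≤ innerL2 v' v' := by
  let S : Set ℝ := {r | ∃ (f : Γ.Point → ℝ) (f' : Γ.EdgeFun), HasH1Deriv f f' ∧
    innerL2 (onEdges f) 1 = 0 ∧ innerL2 (onEdges f) (onEdges f) = 1 ∧ innerL2 f' f' = r}
  have hbdd : BddBelow S := ⟨0, by rintro r ⟨f, f', -, -, -, rfl⟩; exact innerL2_self_nonneg _⟩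
  have hscale : ∀ (v : Γ.Point → ℝ) (v' : Γ.EdgeFun), HasH1Deriv v v' →
      innerL2 (onEdges v) 1 = 0 → v ≠ 0 →
      innerL2 v' v' / innerL2 (onEdges v) (onEdges v) ∈ S := by
    intro v v' hv hv1 hv0
    have hpos := innerL2_self_pos hv.1 hv0
    set N := innerL2 (onEdges v) (onEdges v) with hN
    set c : ℝ := (Real.sqrt N)⁻¹ with hc
    have hc2 : c ^ 2 = N⁻¹ := by rw [hc, inv_pow, Real.sq_sqrt hpos.le]
    have hself : ∀ g : Γ.EdgeFun, innerL2 (c • g) (c • g) = c ^ 2 * innerL2 g g := fun g => by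
      rw [innerL2_smul_left, innerL2_comm, innerL2_smul_left]; ring
    refine ⟨c • v, c • v', ?_, ?_, ?_, ?_⟩
    · simpa using hv.linear_comb hv c 0
    · rw [onEdges_smul, innerL2_smul_left, hv1, mul_zero]
    · rw [onEdges_smul, hself, hc2, ← hN, inv_mul_cancel₀ hpos.ne']
    · rw [hself, hc2]; field_simp
  have hSne : S.Nonempty := by
    obtain ⟨f, f', hf, hf0, hf1⟩ := hne
    exact ⟨_, hscale f f' hf hf1 hf0⟩
  set ν := sInf S with hν
  have hmin : ∀ (v : Γ.Point → ℝ) (v' : Γ.EdgeFun), HasH1Deriv v v' →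
      innerL2 (onEdges v) 1 = 0 → ν * innerL2 (onEdges v) (onEdges v) ≤ innerL2 v' v' := by
    intro v v' hv hv1
    by_cases hv0 : v = 0
    · subst hv0
      have : innerL2 (onEdges (0 : Γ.Point → ℝ)) (onEdges 0) = 0 := by
        have h0 : onEdges (0 : Γ.Point → ℝ) = 0 := rfl
        simp [innerL2, h0]
      rw [this, mul_zero]
      exact innerL2_self_nonneg _
    · exact (le_div_iff₀ (innerL2_self_pos hv.1 hv0)).1 (csInf_le hbdd (hscale v v' hv hv1 hv0))
  obtain ⟨r, hanti, hr, hrS⟩ := exists_seq_tendsto_sInf hSne hbdd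
  choose f0 f0' hf0 hf01 hf0n hf0q using hrS
  obtain ⟨u, φ, hu, hφ, hunif⟩ := HasH1Deriv.exists_subseq_tendsto hf0 (C := max (r 0) 1)
    (fun n => (hf0q n).le.trans ((hanti (Nat.zero_le n)).trans (le_max_left _ _)))
    (fun n => (hf0n n).le.trans (le_max_right _ _))
  obtain ⟨f, hfdef⟩ : ∃ f, f = fun n => f0 (φ n) := ⟨_, rfl⟩
  obtain ⟨f', hfdef'⟩ : ∃ f', f' = fun n => f0' (φ n) := ⟨_, rfl⟩
  have hf : ∀ n, HasH1Deriv (f n) (f' n) := fun n => by rw [hfdef, hfdef']; exact hf0 _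
  have hf1 : ∀ n, innerL2 (onEdges (f n)) 1 = 0 := fun n => by rw [hfdef]; exact hf01 _
  have hfn : ∀ n, innerL2 (onEdges (f n)) (onEdges (f n)) = 1 := fun n => by
    rw [hfdef]; exact hf0n _
  have hq : Filter.Tendsto (fun n => innerL2 (f' n) (f' n)) Filter.atTop (nhds ν) := by
    rw [hfdef']
    exact (hr.comp hφ.tendsto_atTop).congr fun n => (hf0q (φ n)).symm
  rw [← hfdef] at hunif
  have hone : TendstoUniformly (fun _ : ℕ => (1 : Γ.Point → ℝ)) 1 Filter.atTop :=
    Metric.tendstoUniformly_iff.2 fun ε hε => Filter.Eventually.of_forall fun n x => by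
      simpa using hε
  have hu1 : innerL2 (onEdges u) 1 = 0 := by
    refine tendsto_nhds_unique (tendsto_innerL2_of_tendstoUniformly (fun n => (hf n).1)
      (fun _ => continuous_const) hu continuous_const hunif hone) ?_
    exact tendsto_const_nhds.congr fun n => (hf1 n).symm
  have hun : innerL2 (onEdges u) (onEdges u) = 1 := by
    refine tendsto_nhds_unique (tendsto_innerL2_of_tendstoUniformly (fun n => (hf n).1)
      (fun n => (hf n).1) hu hu hunif hunif) ?_
    exact tendsto_const_nhds.congr fun n => (hfn n).symm
  have hd : Filter.Tendsto (fun n => innerL2 (onEdges (f n) - onEdges u)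
      (onEdges (f n) - onEdges u)) Filter.atTop (nhds 0) := by
    have h1 := tendsto_innerL2_of_tendstoUniformly (fun n => (hf n).1)
      (fun _ => hu) hu hu hunif (g := fun _ => u)
      (Metric.tendstoUniformly_iff.2 fun ε hε => Filter.Eventually.of_forall fun n x => by
        simpa using hε)
    have h2 : Filter.Tendsto (fun n => 1 - 2 * innerL2 (onEdges (f n)) (onEdges u) + 1)
        Filter.atTop (nhds (1 - 2 * 1 + 1)) := by
      rw [hun] at h1
      exact ((h1.const_mul 2).const_sub 1).add_const 1
    norm_num at h2
    refine h2.congr fun n => ?_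
    rw [innerL2_sub_self (hf n).memL2 (memL2_onEdges hu), hfn, hun]
  have hν0 : 0 ≤ ν := Real.sInf_nonneg (by
    rintro r ⟨f, f', -, -, -, rfl⟩; exact innerL2_self_nonneg _)
  have hpar : ∀ m n, innerL2 (f' m - f' n) (f' m - f' n)
      ≤ 2 * (innerL2 (f' m) (f' m) - ν) + 2 * (innerL2 (f' n) (f' n) - ν) +
        ν * (2 * innerL2 (onEdges (f m) - onEdges u) (onEdges (f m) - onEdges u) +
          2 * innerL2 (onEdges (f n) - onEdges u) (onEdges (f n) - onEdges u)) := by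
    intro m n
    have hm := (hf m).memL2
    have hn := (hf n).memL2
    have hsum := (hf m).linear_comb (hf n) 1 1
    have hsum1 := hmin _ _ hsum (by
      rw [innerL2_one_linear_comb (hf m).1 (hf n).1, hf1, hf1]
      simp)
    rw [onEdges_linear_comb] at hsum1
    simp only [one_smul] at hsum1
    rw [innerL2_add_self hm hn, innerL2_add_self (hf m).2.1 (hf n).2.1, hfn, hfn] at hsum1
    have e1 := innerL2_sub_self (hf m).2.1 (hf n).2.1
    have e2 := innerL2_sub_self hm hn
    rw [hfn, hfn] at e2
    have e3 := mul_le_mul_of_nonneg_left (innerL2_sub_self_le hm hn (memL2_onEdges hu)) hν0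
    rw [e2] at e3
    linarith
  have hcauchy : ∀ ε > 0, ∃ N, ∀ m ≥ N, ∀ n ≥ N,
      innerL2 (f' m - f' n) (f' m - f' n) < ε := by
    intro ε hε
    have hlim : Filter.Tendsto (fun n => 2 * (innerL2 (f' n) (f' n) - ν) +
        ν * (2 * innerL2 (onEdges (f n) - onEdges u) (onEdges (f n) - onEdges u)))
        Filter.atTop (nhds 0) := by
      have := ((hq.sub_const ν).const_mul 2).add ((hd.const_mul 2).const_mul ν)
      simpa using this
    obtain ⟨N, hN⟩ := Filter.eventually_atTop.1 (hlim.eventually (gt_mem_nhds (half_pos hε)))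
    refine ⟨N, fun m hm n hn => ?_⟩
    have h1 := hN m hm
    have h2 := hN n hn
    have h3 := hpar m n
    linarith
  obtain ⟨u', hu', hlim, hqlim⟩ := exists_tendsto_of_cauchy (fun n => (hf n).2.1) hcauchy
  refine ⟨ν, u, u', hasH1Deriv_of_tendsto hf hu hu' hunif hlim, ?_, hu1, ?_, hmin⟩
  · rintro rfl
    have h0 : onEdges (0 : Γ.Point → ℝ) = 0 := rfl
    simp [innerL2, h0] at hun
  · rw [hun, mul_one]
    exact tendsto_nhds_unique hqlim hq

/-! ### The second eigenvalue -/

/-- The Euler–Lagrange equation: a minimizer of the Rayleigh quotient among the functions with mean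
zero is an eigenfunction. -/
theorem isEigenfunction_of_rayleigh_minimizer (hL : 0 < Γ.totalLength) {ν : ℝ} {u : Γ.Point → ℝ}
    {u' : Γ.EdgeFun} (hu : HasH1Deriv u u') (hu0 : u ≠ 0) (hu1 : innerL2 (onEdges u) 1 = 0)
    (huq : innerL2 u' u' = ν * innerL2 (onEdges u) (onEdges u))
    (hmin : ∀ (v : Γ.Point → ℝ) (v' : Γ.EdgeFun), HasH1Deriv v v' → innerL2 (onEdges v) 1 = 0 →
        ν * innerL2 (onEdges v) (onEdges v) ≤ innerL2 v' v') : IsEigenfunction ν u := by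
  refine ⟨hu0, memL2_onEdges (hu.1.const_smul ν), u', hu, fun v v' hv => ?_⟩
  rw [onEdges_smul, innerL2_smul_left]
  -- subtract from `v` its mean
  set c := innerL2 (onEdges v) 1 / Γ.totalLength with hc
  have hw := hv.linear_comb hasH1Deriv_one 1 (-c)
  have hw1 := innerL2_sub_mean_one hv.1 hL
  rw [← hc] at hw1
  set w : Γ.Point → ℝ := (1 : ℝ) • v + (-c) • 1 with hwdef
  set w' : Γ.EdgeFun := (1 : ℝ) • v' + (-c) • 0 with hwdef'
  have hww' : w' = v' := by simp [hwdef']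
  have huw : innerL2 (onEdges u) (onEdges w) = innerL2 (onEdges u) (onEdges v) := by
    rw [innerL2_comm, hwdef, onEdges_linear_comb, onEdges_one, innerL2_linear_comb_left hv.memL2
      memL2_one hu.memL2, innerL2_comm 1, hu1, innerL2_comm]
    ring
  rw [← huw, ← hww']
  have hquad : ∀ t : ℝ, 0 ≤ (innerL2 w' w' - ν * innerL2 (onEdges w) (onEdges w)) * (t * t)
      + (2 * (innerL2 u' w' - ν * innerL2 (onEdges u) (onEdges w))) * t + 0 := by
    intro t
    have h1 := hmin _ _ (hu.linear_comb hw 1 t) (by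
      rw [innerL2_one_linear_comb hu.1 hw.1, hu1, hw1]
      simp)
    rw [onEdges_linear_comb, innerL2_linear_comb_self hu.memL2 hw.memL2,
      innerL2_linear_comb_self hu.2.1 hw.2.1, huq] at h1
    linarith
  have hdisc := discrim_le_zero hquad
  rw [discrim] at hdisc
  have hsq : (innerL2 u' w' - ν * innerL2 (onEdges u) (onEdges w)) ^ 2 ≤ 0 := by linarith
  exact sub_eq_zero.1 (pow_eq_zero_iff two_ne_zero |>.1 (le_antisymm hsq (sq_nonneg _)))

theorem isEigenfunction_one (hL : 0 < Γ.totalLength) :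
    IsEigenfunction 0 (1 : Γ.Point → ℝ) := by
  refine ⟨fun h => ?_, memL2_onEdges (continuous_const (y := (0 : ℝ) • (1 : ℝ))), 0,
    hasH1Deriv_one, fun v v' _ => ?_⟩
  · have : innerL2 (1 : Γ.EdgeFun) 1 = innerL2 (onEdges (0 : Γ.Point → ℝ)) 1 := by
      rw [← onEdges_one, h]
    rw [innerL2_one_one] at this
    have h0 : onEdges (0 : Γ.Point → ℝ) = 0 := rfl
    simp [innerL2, h0] at this
    exact hL.ne' this
  · rw [onEdges_smul, innerL2_smul_left, zero_mul]
    simp [innerL2]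

/-- If there are two linearly independent eigenfunctions with eigenvalues `≤ t`, then some nonzero
linear combination of them satisfies a given linear condition `κ f = 0`, and its Rayleigh quotient
is at most `t`. -/
theorem exists_rayleigh_le_of_mem_eigenvalueCountSet {t : ℝ} (ht : t ∈ Γ.eigenvalueCountSet 2)
    (κ : (Γ.Point → ℝ) → ℝ) (hκ : ∀ f g, Continuous f → Continuous g → ∀ a b : ℝ,
      κ (a • f + b • g) = a * κ f + b * κ g) :
    ∃ (f : Γ.Point → ℝ) (f' : Γ.EdgeFun), HasH1Deriv f f' ∧ f ≠ 0 ∧ κ f = 0 ∧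
      innerL2 f' f' ≤ t * innerL2 (onEdges f) (onEdges f) := by
  obtain ⟨u, hlin, hu⟩ := ht
  obtain ⟨ν₀, hν₀, -, -, u₀', h₀, e₀⟩ := hu 0
  obtain ⟨ν₁, hν₁, -, -, u₁', h₁, e₁⟩ := hu 1
  obtain ⟨a, b, hab, hκ0⟩ : ∃ a b : ℝ, ¬ (a = 0 ∧ b = 0) ∧ a * κ (u 0) + b * κ (u 1) = 0 := by
    by_cases h : κ (u 0) = 0 ∧ κ (u 1) = 0
    · exact ⟨1, 0, by simp, by simp [h.1]⟩
    · exact ⟨κ (u 1), -κ (u 0), by simpa [and_comm] using h, by ring⟩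
  have h00 := e₀ _ _ h₀
  have h01 := e₀ _ _ h₁
  have h10 := e₁ _ _ h₀
  have h11 := e₁ _ _ h₁
  simp only [onEdges_smul, innerL2_smul_left] at h00 h01 h10 h11
  rw [innerL2_comm u₁', innerL2_comm (onEdges (u 1))] at h10
  refine ⟨_, _, h₀.linear_comb h₁ a b, fun h => hab ?_, by rw [hκ _ _ h₀.1 h₁.1, hκ0], ?_⟩
  · rw [Fintype.linearIndependent_iff] at hlin
    have := hlin ![a, b] (by simpa [Fin.sum_univ_two] using h)
    exact ⟨this 0, this 1⟩
  · rw [onEdges_linear_comb, innerL2_linear_comb_self h₀.2.1 h₁.2.1]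
    have hn := innerL2_self_nonneg (a • onEdges (u 0) + b • onEdges (u 1))
    rw [innerL2_linear_comb_self h₀.memL2 h₁.memL2] at hn ⊢
    rw [h00, h11]
    have hp0 := innerL2_self_nonneg (onEdges (u 0))
    have hp1 := innerL2_self_nonneg (onEdges (u 1))
    -- eigenfunctions for distinct eigenvalues are orthogonal
    by_cases hν : ν₀ = ν₁
    · subst hν
      rw [h01]
      linarith [mul_nonneg (sub_nonneg.2 hν₀) hn]
    · have horth : innerL2 (onEdges (u 0)) (onEdges (u 1)) = 0 := by
        have : (ν₀ - ν₁) * innerL2 (onEdges (u 0)) (onEdges (u 1)) = 0 := by linarith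
        exact (mul_eq_zero.1 this).resolve_left (sub_ne_zero.2 hν)
      rw [h01, horth]
      linarith [mul_nonneg (sub_nonneg.2 hν₀) (mul_nonneg (sq_nonneg a) hp0),
        mul_nonneg (sub_nonneg.2 hν₁) (mul_nonneg (sq_nonneg b) hp1)]

/-- The variational characterization of the second eigenvalue. -/
theorem isLeast_mu_two (hL : 0 < Γ.totalLength)
    (hne : ∃ (f : Γ.Point → ℝ) (f' : Γ.EdgeFun), HasH1Deriv f f' ∧
      f ≠ 0 ∧ innerL2 (onEdges f) 1 = 0) :
    IsLeast (Γ.eigenvalueCountSet 2) (Γ.mu 2) ∧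
      ∀ (v : Γ.Point → ℝ) (v' : Γ.EdgeFun), HasH1Deriv v v' → innerL2 (onEdges v) 1 = 0 →
        Γ.mu 2 * innerL2 (onEdges v) (onEdges v) ≤ innerL2 v' v' := by
  obtain ⟨ν, u, u', hu, hu0, hu1, huq, hmin⟩ := exists_rayleigh_minimizer hne
  have hpos := innerL2_self_pos hu.1 hu0
  have hν : 0 ≤ ν := by
    have := innerL2_self_nonneg u'
    rw [huq] at this
    exact nonneg_of_mul_nonneg_left this hpos
  have hleast : IsLeast (Γ.eigenvalueCountSet 2) ν := by
    refine ⟨⟨![1, u], ?_, ?_⟩, fun t ht => ?_⟩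
    · rw [LinearIndependent.pair_iff]
      intro a b hab
      have h1 := innerL2_one_linear_comb (continuous_const (y := (1 : ℝ))) hu.1 a b
      have hab' : a • (fun _ => (1 : ℝ)) + b • u = 0 := hab
      have e1 : onEdges (fun _ : Γ.Point => (1 : ℝ)) = 1 := rfl
      have e0 : onEdges (0 : Γ.Point → ℝ) = 0 := rfl
      rw [hab', hu1, e1, innerL2_one_one, e0, show innerL2 (0 : Γ.EdgeFun) 1 = 0 by
        simp [innerL2]] at h1
      have ha : a = 0 := by
        have : a * Γ.totalLength = 0 := by linarith
        exact (mul_eq_zero.1 this).resolve_right hL.ne'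
      refine ⟨ha, ?_⟩
      rw [ha, zero_smul, zero_add] at hab
      exact (smul_eq_zero.1 hab).resolve_right hu0
    · intro i
      fin_cases i
      · exact ⟨0, hν, isEigenfunction_one hL⟩
      · exact ⟨ν, le_rfl, isEigenfunction_of_rayleigh_minimizer hL hu hu0 hu1 huq hmin⟩
    · obtain ⟨f, f', hf, hf0, hf1, hfq⟩ := exists_rayleigh_le_of_mem_eigenvalueCountSet ht
        (fun f => innerL2 (onEdges f) 1) fun f g hf hg a b => innerL2_one_linear_comb hf hg a b
      exact le_of_mul_le_mul_right ((hmin f f' hf hf1).trans hfq) (innerL2_self_pos hf.1 hf0)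
  have hmu : Γ.mu 2 = ν := hleast.csInf_eq
  rw [hmu]
  exact ⟨hleast, hmin⟩

end CompactMetricGraph

/-! ### The upper bound -/

theorem integral_sq_mul_sin (ω a l : ℝ) :
    ∫ x in (0 : ℝ)..l, (ω * Real.sin (ω * (x - a))) ^ 2
      = ω ^ 2 * l / 2 - ω * (Real.sin (2 * (ω * (l - a))) + Real.sin (2 * (ω * a))) / 4 := by
  have hd : ∀ x, HasDerivAt (fun x => ω ^ 2 * (x / 2) - ω / 4 * Real.sin (2 * (ω * (x - a))))
      ((ω * Real.sin (ω * (x - a))) ^ 2) x := by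
    intro x
    have h1 : HasDerivAt (fun x => 2 * (ω * (x - a))) (2 * (ω * 1)) x :=
      (((hasDerivAt_id x).sub_const a).const_mul ω).const_mul 2
    have h2 := (((hasDerivAt_id x).div_const 2).const_mul (ω ^ 2)).sub (h1.sin.const_mul (ω / 4))
    convert! h2 using 1
    rw [Real.cos_two_mul, Real.cos_sq']
    ring
  rw [intervalIntegral.integral_eq_sub_of_hasDerivAt (fun x _ => hd x)
    (Continuous.intervalIntegrable (by fun_prop) _ _)]
  rw [show 2 * (ω * (0 - a)) = -(2 * (ω * a)) by ring, Real.sin_neg]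
  ring

theorem integral_sq_mul_cos_sub (ω a l A c : ℝ) (hω : ω ≠ 0) :
    ∫ x in (0 : ℝ)..l, (A * Real.cos (ω * (x - a)) - c) ^ 2
      = A ^ 2 * (l / 2 + (Real.sin (2 * (ω * (l - a))) + Real.sin (2 * (ω * a))) / (4 * ω))
        - 2 * A * c * (Real.sin (ω * (l - a)) + Real.sin (ω * a)) / ω + c ^ 2 * l := by
  have hd : ∀ x, HasDerivAt (fun x => A ^ 2 * (x / 2 + Real.sin (2 * (ω * (x - a))) / (4 * ω))
      - 2 * A * c * (Real.sin (ω * (x - a)) / ω) + c ^ 2 * x)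
      ((A * Real.cos (ω * (x - a)) - c) ^ 2) x := by
    intro x
    have h0 : HasDerivAt (fun x => ω * (x - a)) (ω * 1) x :=
      ((hasDerivAt_id x).sub_const a).const_mul ω
    have h1 : HasDerivAt (fun x => 2 * (ω * (x - a))) (2 * (ω * 1)) x := h0.const_mul 2
    have h2 := (((((hasDerivAt_id x).div_const 2).add (h1.sin.div_const (4 * ω))).const_mul
      (A ^ 2)).sub ((h0.sin.div_const ω).const_mul (2 * A * c))).add
      ((hasDerivAt_id x).const_mul (c ^ 2))
    convert! h2 using 1
    rw [Real.cos_two_mul]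
    field_simp
    ring
  rw [intervalIntegral.integral_eq_sub_of_hasDerivAt (fun x _ => hd x)
    (Continuous.intervalIntegrable (by fun_prop) _ _)]
  rw [show 2 * (ω * (0 - a)) = -(2 * (ω * a)) by ring, Real.sin_neg,
    show ω * (0 - a) = -(ω * a) by ring, Real.sin_neg]
  field_simp
  ring

/-- Two of `n ≥ 2` numbers have a mean that is at least the overall mean: average over the pairs of
cyclic neighbours. -/
theorem exists_ne_two_mul_sum_le {n : ℕ} (hn : 2 ≤ n) (l : Fin n → ℝ) :
    ∃ i j, i ≠ j ∧ 2 * ∑ k, l k ≤ n * (l i + l j) := by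
  obtain ⟨m, rfl⟩ := Nat.exists_eq_add_of_le' hn
  have hsum : ∑ k : Fin (m + 2), (2 * ∑ k, l k) / ((m + 2 : ℕ) : ℝ)
      ≤ ∑ k : Fin (m + 2), (l k + l (k + 1)) := by
    have hshift : ∑ k : Fin (m + 2), l (k + 1) = ∑ k, l k :=
      Equiv.sum_comp (Equiv.addRight (1 : Fin (m + 2))) l
    rw [Finset.sum_add_distrib, hshift]
    simp only [Finset.sum_const, Finset.card_univ, Fintype.card_fin, nsmul_eq_mul]
    rw [mul_div_cancel₀ _ (by positivity)]
    linarith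
  obtain ⟨k, -, hk⟩ := Finset.exists_le_of_sum_le Finset.univ_nonempty hsum
  refine ⟨k, k + 1, by simp, ?_⟩
  rw [div_le_iff₀ (by positivity)] at hk
  linarith

theorem isPrimitiveOn_mul_cos_add (ω a A D l : ℝ) (hl : 0 ≤ l) :
    IsPrimitiveOn (fun x => A * Real.cos (ω * (x - a)) + D)
      (fun x => -A * (ω * Real.sin (ω * (x - a)))) 0 l := by
  refine IsPrimitiveOn.of_hasDerivAt hl (fun x _ => ?_) (by fun_prop)
  have h0 : HasDerivAt (fun x => ω * (x - a)) (ω * 1) x :=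
    ((hasDerivAt_id x).sub_const a).const_mul ω
  convert! (h0.cos.const_mul A).add_const D using 1
  ring

namespace CompactMetricGraph

variable {Γ : CompactMetricGraph}

/-- A trial function: on an edge `[0, ℓ]`, the function `cos (π x / ℓ)`. -/
theorem exists_rayleigh_le_of_numEdges_eq_one (hm : Γ.numEdges = 1) (hΓ : ¬ Γ.IsSingleLoop) :
    ∃ (f : Γ.Point → ℝ) (f' : Γ.EdgeFun), HasH1Deriv f f' ∧ ∀ c : ℝ,
      0 < innerL2 (onEdges ((1 : ℝ) • f + (-c) • 1)) (onEdges ((1 : ℝ) • f + (-c) • 1)) ∧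
      innerL2 f' f' ≤ Real.pi ^ 2 * (Γ.numEdges : ℝ) ^ 2 / Γ.totalLength ^ 2 *
        innerL2 (onEdges ((1 : ℝ) • f + (-c) • 1)) (onEdges ((1 : ℝ) • f + (-c) • 1)) := by
  have hsub : Subsingleton (Fin Γ.numEdges) := by rw [hm]; infer_instance
  have k : Fin Γ.numEdges := ⟨0, by omega⟩
  have hl := Γ.len_pos k
  have hL : Γ.totalLength = Γ.len k := Fintype.sum_subsingleton _ k
  set ω : ℝ := Real.pi / Γ.len k with hω
  have hω0 : 0 < ω := div_pos Real.pi_pos hl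
  have hωl : ω * Γ.len k = Real.pi := by rw [hω]; field_simp
  have hnot : ∀ j, ¬ Γ.glue (j, false) (j, true) := fun j hj =>
    hΓ ⟨hm, fun i => by rwa [Subsingleton.elim i j]⟩
  have hcompat : ∀ s t, Γ.glue s t →
      (fun (_ : Fin Γ.numEdges) x => 1 * Real.cos (ω * (x - 0)) + 0) s.1 ((Γ.endpoint s).2 : ℝ)
      = (fun (_ : Fin Γ.numEdges) x => 1 * Real.cos (ω * (x - 0)) + 0) t.1
        ((Γ.endpoint t).2 : ℝ) := by
    rintro ⟨i, b⟩ ⟨j, c⟩ hst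
    obtain rfl := Subsingleton.elim i j
    have hbc : b = c := by
      cases b <;> cases c
      · rfl
      · exact absurd hst (hnot i)
      · exact absurd (Γ.glue.symm hst) (hnot i)
      · rfl
    rw [hbc]
  have hH1 : HasH1Deriv (ofEdges (Γ := Γ) (fun _ x => 1 * Real.cos (ω * (x - 0)) + 0) hcompat)
      (fun _ x => -1 * (ω * Real.sin (ω * (x - 0)))) :=
    hasH1Deriv_ofEdges hcompat (memL2_of_continuousOn fun k => by fun_prop)
      fun k => isPrimitiveOn_mul_cos_add _ _ _ _ _ (Γ.len_pos k).le
  refine ⟨_, _, hH1, fun c => ?_⟩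
  set f := ofEdges (Γ := Γ) (fun _ x => 1 * Real.cos (ω * (x - 0)) + 0) hcompat with hf
  have hn : innerL2 (onEdges ((1 : ℝ) • f + (-c) • 1)) (onEdges ((1 : ℝ) • f + (-c) • 1))
      = Γ.len k / 2 + c ^ 2 * Γ.len k := by
    have : ∀ x ∈ uIcc 0 (Γ.len k), onEdges ((1 : ℝ) • f + (-c) • 1) k x ^ 2
        = (1 * Real.cos (ω * (x - 0)) - c) ^ 2 := by
      intro x hx
      rw [uIcc_of_le hl.le] at hx
      have h1 : onEdges ((1 : ℝ) • f + (-c) • 1) k x = 1 * onEdges f k x + -c * 1 := rfl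
      rw [h1, hf, onEdges_ofEdges hcompat hx]
      ring
    rw [innerL2_self, Fintype.sum_subsingleton _ k, intervalIntegral.integral_congr this,
      integral_sq_mul_cos_sub _ _ _ _ _ hω0.ne', sub_zero, hωl]
    simp
  have hq : innerL2 (fun _ x => -1 * (ω * Real.sin (ω * (x - 0))) : Γ.EdgeFun)
      (fun _ x => -1 * (ω * Real.sin (ω * (x - 0)))) = ω ^ 2 * (Γ.len k / 2) := by
    rw [innerL2_self, Fintype.sum_subsingleton _ k]
    simp only [neg_one_mul, neg_sq]
    rw [integral_sq_mul_sin, sub_zero, hωl]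
    simp
    ring
  rw [hn, hq, hL, hm]
  refine ⟨by positivity, ?_⟩
  rw [show Real.pi ^ 2 * ((1 : ℕ) : ℝ) ^ 2 / Γ.len k ^ 2 = ω ^ 2 by rw [hω]; simp [div_pow]]
  exact mul_le_mul_of_nonneg_left (by nlinarith [mul_nonneg (sq_nonneg c) hl.le]) (sq_nonneg _)

/-- A trial function: two edges of lengths `a`, `b` with `a + b ≥ 2 L / m`, with all four end points
identified, form a loop of length `a + b` on which two points are glued. An eigenfunction
`cos (2 π x / (a + b))` of the loop, suitably rotated, has equal values at these points, and
is extended by this value to the other edges. It has mean zero on the loop, so subtracting a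
constant does not decrease the square norm there. -/
theorem exists_rayleigh_le_of_two_le_numEdges (hm : 2 ≤ Γ.numEdges) :
    ∃ (f : Γ.Point → ℝ) (f' : Γ.EdgeFun), HasH1Deriv f f' ∧ ∀ c : ℝ,
      0 < innerL2 (onEdges ((1 : ℝ) • f + (-c) • 1)) (onEdges ((1 : ℝ) • f + (-c) • 1)) ∧
      innerL2 f' f' ≤ Real.pi ^ 2 * (Γ.numEdges : ℝ) ^ 2 / Γ.totalLength ^ 2 *
        innerL2 (onEdges ((1 : ℝ) • f + (-c) • 1)) (onEdges ((1 : ℝ) • f + (-c) • 1)) := by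
  obtain ⟨i, j, hij, hsum⟩ := exists_ne_two_mul_sum_le hm Γ.len
  change 2 * Γ.totalLength ≤ _ at hsum
  have hi := Γ.len_pos i
  have hj := Γ.len_pos j
  have hL : 0 < Γ.totalLength := Finset.sum_pos (fun k _ => Γ.len_pos k) ⟨i, Finset.mem_univ i⟩
  have hij0 : 0 < Γ.len i + Γ.len j := by positivity
  set ω : ℝ := 2 * Real.pi / (Γ.len i + Γ.len j) with hω
  have hω0 : 0 < ω := div_pos Real.two_pi_pos hij0
  have hωl : ω * Γ.len j = 2 * Real.pi - ω * Γ.len i := by rw [hω]; field_simp; ring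
  have hcosj : Real.cos (ω * (Γ.len j / 2)) = -Real.cos (ω * (Γ.len i / 2)) := by
    rw [show ω * (Γ.len j / 2) = Real.pi - ω * (Γ.len i / 2) by linarith, Real.cos_pi_sub]
  have hsinj : Real.sin (ω * (Γ.len j / 2)) = Real.sin (ω * (Γ.len i / 2)) := by
    rw [show ω * (Γ.len j / 2) = Real.pi - ω * (Γ.len i / 2) by linarith, Real.sin_pi_sub]
  have hsin2 : Real.sin (2 * (ω * (Γ.len j / 2))) = -Real.sin (2 * (ω * (Γ.len i / 2))) := by
    rw [Real.sin_two_mul, Real.sin_two_mul, hsinj, hcosj]; ring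
  -- amplitudes and additive constants on the edges
  set A : Fin Γ.numEdges → ℝ := fun k => if k = i then 1 else if k = j then -1 else 0 with hA
  set D : Fin Γ.numEdges → ℝ := fun k => if k = i ∨ k = j then 0
    else Real.cos (ω * (Γ.len i / 2)) with hD
  have hAi : A i = 1 := by simp [hA]
  have hAj : A j = -1 := by simp [hA, hij.symm]
  have hDi : D i = 0 := by simp [hD]
  have hDj : D j = 0 := by simp [hD]
  let F : Γ.EdgeFun := fun k x => A k * Real.cos (ω * (x - Γ.len k / 2)) + D k
  let F' : Γ.EdgeFun := fun k x => -A k * (ω * Real.sin (ω * (x - Γ.len k / 2)))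
  have hval : ∀ s, F s.1 (Γ.endpoint s).2 = Real.cos (ω * (Γ.len i / 2)) := by
    rintro ⟨k, b⟩
    have hcos : F k ((Γ.endpoint (k, b)).2 : ℝ) = A k * Real.cos (ω * (Γ.len k / 2)) + D k := by
      cases b
      · change A k * Real.cos (ω * (0 - Γ.len k / 2)) + D k = _
        rw [show ω * (0 - Γ.len k / 2) = -(ω * (Γ.len k / 2)) by ring, Real.cos_neg]
      · change A k * Real.cos (ω * (Γ.len k - Γ.len k / 2)) + D k = _
        rw [sub_half]
    rw [hcos]
    by_cases h1 : k = i
    · subst h1; rw [hAi, hDi]; ring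
    by_cases h2 : k = j
    · subst h2; rw [hAj, hDj, hcosj]; ring
    · simp [hA, hD, h1, h2]
  have hcompat : ∀ s t, Γ.glue s t → F s.1 (Γ.endpoint s).2 = F t.1 (Γ.endpoint t).2 :=
    fun s t _ => (hval s).trans (hval t).symm
  have hH1 : HasH1Deriv (ofEdges F hcompat) F' :=
    hasH1Deriv_ofEdges hcompat (memL2_of_continuousOn fun k => by fun_prop)
      fun k => isPrimitiveOn_mul_cos_add _ _ _ _ _ (Γ.len_pos k).le
  refine ⟨_, _, hH1, fun c => ?_⟩
  set f := ofEdges F hcompat with hf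
  have hq : innerL2 F' F' = ω ^ 2 * ((Γ.len i + Γ.len j) / 2) := by
    have hF' : ∀ k, ∫ x in (0 : ℝ)..Γ.len k, F' k x ^ 2 = A k ^ 2 *
        (ω ^ 2 * Γ.len k / 2 - ω * (2 * Real.sin (2 * (ω * (Γ.len k / 2)))) / 4) := by
      intro k
      simp only [F', mul_pow (-A k), intervalIntegral.integral_const_mul]
      rw [integral_sq_mul_sin, sub_half]
      ring
    rw [innerL2_self, Fintype.sum_eq_add i j hij]
    · rw [hF', hF', hAi, hAj, hsin2]
      ring
    · rintro k ⟨h1, h2⟩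
      rw [hF']
      simp [hA, h1, h2]
  have hn : (Γ.len i + Γ.len j) / 2 ≤
      innerL2 (onEdges ((1 : ℝ) • f + (-c) • 1)) (onEdges ((1 : ℝ) • f + (-c) • 1)) := by
    have hk : ∀ k, D k = 0 → ∫ x in (0 : ℝ)..Γ.len k, onEdges ((1 : ℝ) • f + (-c) • 1) k x ^ 2
        = A k ^ 2 * (Γ.len k / 2 + 2 * Real.sin (2 * (ω * (Γ.len k / 2))) / (4 * ω))
          - 2 * A k * c * (2 * Real.sin (ω * (Γ.len k / 2))) / ω + c ^ 2 * Γ.len k := by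
      intro k hDk
      have : ∀ x ∈ uIcc 0 (Γ.len k), onEdges ((1 : ℝ) • f + (-c) • 1) k x ^ 2
          = (A k * Real.cos (ω * (x - Γ.len k / 2)) - c) ^ 2 := by
        intro x hx
        rw [uIcc_of_le (Γ.len_pos k).le] at hx
        have h1 : onEdges ((1 : ℝ) • f + (-c) • 1) k x = 1 * onEdges f k x + -c * 1 := rfl
        rw [h1, hf, onEdges_ofEdges hcompat hx]
        simp only [F, hDk]
        ring
      rw [intervalIntegral.integral_congr this, integral_sq_mul_cos_sub _ _ _ _ _ hω0.ne', sub_half]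
      ring
    have hpair := Finset.sum_le_univ_sum_of_nonneg (s := {i, j})
      fun k => integral_sq_nonneg (onEdges ((1 : ℝ) • f + (-c) • 1)) k
    rw [Finset.sum_pair hij, hk i hDi, hk j hDj, hAi, hAj, hsin2, hsinj, ← innerL2_self] at hpair
    refine le_trans ?_ hpair
    have : 0 ≤ c ^ 2 * (Γ.len i + Γ.len j) := by positivity
    field_simp
    nlinarith
  refine ⟨lt_of_lt_of_le (by positivity) hn, ?_⟩
  rw [hq]
  refine mul_le_mul ?_ hn (by positivity) (by positivity)
  rw [show Real.pi ^ 2 * (Γ.numEdges : ℝ) ^ 2 / Γ.totalLength ^ 2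
    = (Real.pi * Γ.numEdges / Γ.totalLength) ^ 2 by ring]
  refine pow_le_pow_left₀ hω0.le ?_ 2
  rw [hω, div_le_div_iff₀ hij0 hL]
  nlinarith [Real.pi_pos]

/-- The upper bound `μ₂ ≤ π² m² / L²`, together with the existence of `μ₂`. -/
theorem isLeast_mu_two_and_le (hL : 0 < Γ.totalLength) (hΓ : ¬ Γ.IsSingleLoop) :
    IsLeast (Γ.eigenvalueCountSet 2) (Γ.mu 2) ∧
      Γ.mu 2 ≤ Real.pi ^ 2 * (Γ.numEdges : ℝ) ^ 2 / Γ.totalLength ^ 2 := by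
  have hm : Γ.numEdges ≠ 0 := by
    intro h
    have : IsEmpty (Fin Γ.numEdges) := by rw [h]; infer_instance
    simp [totalLength] at hL
  obtain ⟨f, f', hf, hfc⟩ : ∃ (f : Γ.Point → ℝ) (f' : Γ.EdgeFun), HasH1Deriv f f' ∧ ∀ c : ℝ,
      0 < innerL2 (onEdges ((1 : ℝ) • f + (-c) • 1)) (onEdges ((1 : ℝ) • f + (-c) • 1)) ∧
      innerL2 f' f' ≤ Real.pi ^ 2 * (Γ.numEdges : ℝ) ^ 2 / Γ.totalLength ^ 2 *
        innerL2 (onEdges ((1 : ℝ) • f + (-c) • 1)) (onEdges ((1 : ℝ) • f + (-c) • 1)) := by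
    by_cases h1 : Γ.numEdges = 1
    · exact exists_rayleigh_le_of_numEdges_eq_one h1 hΓ
    · exact exists_rayleigh_le_of_two_le_numEdges (by omega)
  obtain ⟨hpos, hle⟩ := hfc (innerL2 (onEdges f) 1 / Γ.totalLength)
  have hw := hf.linear_comb hasH1Deriv_one 1 (-(innerL2 (onEdges f) 1 / Γ.totalLength))
  have hw1 := innerL2_sub_mean_one hf.1 hL
  obtain ⟨hleast, hmin⟩ := isLeast_mu_two hL ⟨_, _, hw, fun h0 => by
    rw [h0] at hpos
    have e0 : onEdges (0 : Γ.Point → ℝ) = 0 := rfl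
    simp [innerL2, e0] at hpos, hw1⟩
  refine ⟨hleast, ?_⟩
  have h := hmin _ _ hw hw1
  simp only [one_smul, smul_zero, add_zero] at h hle hpos
  exact le_of_mul_le_mul_right (h.trans hle) hpos

end CompactMetricGraph

/-! ### Cases of equality -/

/-- Poincaré inequality on an interval whose points have distance at most `r` from `c`, for
functions vanishing at each end point different from `c`. -/
theorem IsPrimitiveOn.pi_div_sq_mul_integral_sq_le {F g : ℝ → ℝ} {a b c r : ℝ}
    (h : IsPrimitiveOn F g a b) (hab : a ≤ b)
    (hg : IntervalIntegrable (fun x => g x ^ 2) volume a b) (hr : 0 < r)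
    (hc : ∀ x ∈ Icc a b, |x - c| ≤ r) (ha : F a = 0 ∨ a = c) (hb : F b = 0 ∨ b = c) :
    (Real.pi / (2 * r)) ^ 2 * ∫ x in a..b, F x ^ 2 ≤ ∫ x in a..b, g x ^ 2 := by
  have hpos : 0 < Real.pi / (2 * r) := div_pos Real.pi_pos (by positivity)
  have hlim : Filter.Tendsto (fun ω : ℝ => ω ^ 2 * ∫ x in a..b, F x ^ 2)
      (nhdsWithin (Real.pi / (2 * r)) (Iio (Real.pi / (2 * r))))
      (nhds ((Real.pi / (2 * r)) ^ 2 * ∫ x in a..b, F x ^ 2)) := by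
    have : Continuous fun ω : ℝ => ω ^ 2 * ∫ x in a..b, F x ^ 2 := by fun_prop
    exact (this.tendsto _).mono_left nhdsWithin_le_nhds
  refine le_of_tendsto hlim ?_
  filter_upwards [Ioo_mem_nhdsLT hpos] with ω hω
  refine h.sq_mul_integral_sq_le hab hg (fun x hx => ?_) ha hb
  rw [abs_mul, abs_of_pos hω.1]
  calc ω * |x - c| ≤ ω * r := mul_le_mul_of_nonneg_left (hc x hx) hω.1.le
    _ < Real.pi / (2 * r) * r := mul_lt_mul_of_pos_right hω.2 hr
    _ = Real.pi / 2 := by field_simp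

namespace CompactMetricGraph

variable {Γ : CompactMetricGraph}

theorem onEdges_eq_of_glue (f : Γ.Point → ℝ) {s t : Fin Γ.numEdges × Bool} (h : Γ.glue s t) :
    onEdges f s.1 (Γ.endpoint s).2 = onEdges f t.1 (Γ.endpoint t).2 := by
  refine (onEdges_apply f (k := s.1) (Γ.endpoint s).2.2).trans (Eq.trans ?_
    (onEdges_apply f (k := t.1) (Γ.endpoint t).2.2).symm)
  exact congrArg f (Quotient.sound (s := Γ.pointSetoid) (Or.inr ⟨s, t, h, rfl, rfl⟩))

/-- In an equilateral flower, functions that vanish at the vertex satisfy the Poincaré inequality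
with Dirichlet conditions on every edge. -/
theorem le_of_mem_eigenvalueCountSet_of_isFlower (hL : 0 < Γ.totalLength) (hF : Γ.IsFlower)
    (hE : Γ.IsEquilateral) {t : ℝ} (ht : t ∈ Γ.eigenvalueCountSet 2) :
    Real.pi ^ 2 * (Γ.numEdges : ℝ) ^ 2 / Γ.totalLength ^ 2 ≤ t := by
  have hm : 0 < Γ.numEdges := by
    refine Nat.pos_of_ne_zero fun h => ?_
    have : IsEmpty (Fin Γ.numEdges) := by rw [h]; infer_instance
    simp [totalLength] at hL
  let k₀ : Fin Γ.numEdges := ⟨0, hm⟩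
  set l := Γ.len k₀ with hl
  have hl0 : 0 < l := Γ.len_pos k₀
  have hlen : ∀ k, Γ.len k = l := fun k => hE k k₀
  have htot : Γ.totalLength = Γ.numEdges * l := by simp [totalLength, hlen]
  have hm' : (0 : ℝ) < Γ.numEdges := by exact_mod_cast hm
  obtain ⟨f, f', hf, hf0, hv, hq⟩ := exists_rayleigh_le_of_mem_eigenvalueCountSet ht
    (fun f => onEdges f k₀ (Γ.endpoint (k₀, false)).2) (fun _ _ _ _ _ _ => rfl)
  have hv' : ∀ s, onEdges f s.1 (Γ.endpoint s).2 = 0 := fun s =>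
    (onEdges_eq_of_glue f (hF s (k₀, false))).trans hv
  have hP : (Real.pi / l) ^ 2 * innerL2 (onEdges f) (onEdges f) ≤ innerL2 f' f' := by
    rw [innerL2_self, innerL2_self, Finset.mul_sum]
    refine Finset.sum_le_sum fun k _ => ?_
    have h := (hf.isPrimitiveOn k).pi_div_sq_mul_integral_sq_le (Γ.len_pos k).le
      (hf.2.1.intervalIntegrable_sq k) (c := l / 2) (half_pos hl0) (fun x hx => ?_)
      (Or.inl (hv' (k, false))) (Or.inl (hv' (k, true)))
    · rwa [mul_div_cancel₀ _ two_ne_zero] at h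
    · rw [hlen k] at hx
      rw [abs_le]
      constructor <;> linarith [hx.1, hx.2]
  rw [htot, show Real.pi ^ 2 * (Γ.numEdges : ℝ) ^ 2 / (Γ.numEdges * l) ^ 2 = (Real.pi / l) ^ 2 by
    field_simp]
  exact le_of_mul_le_mul_right (hP.trans hq) (innerL2_self_pos hf.1 hf0)

/-- The graph with two vertices and two edges of length one joining them: a circle of length two
with two opposite vertices. -/
def twoPumpkin : CompactMetricGraph where
  numEdges := 2
  len _ := 1
  len_pos _ := one_pos
  glue := Setoid.ker Prod.snd

theorem totalLength_twoPumpkin : twoPumpkin.totalLength = 2 := by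
  change ∑ _k : Fin 2, (1 : ℝ) = 2
  simp

/-- The functions `f` on the pumpkin whose values at the midpoints of the two edges add up to zero
satisfy the sharp Poincaré inequality: the difference of the restrictions of `f` to the edges
vanishes at both end points, and their sum vanishes at the midpoint. -/
theorem le_of_mem_eigenvalueCountSet_twoPumpkin {t : ℝ}
    (ht : t ∈ twoPumpkin.eigenvalueCountSet 2) : Real.pi ^ 2 ≤ t := by
  obtain ⟨f, f', hf, hf0, hv, hq⟩ := exists_rayleigh_le_of_mem_eigenvalueCountSet ht
    (fun f => onEdges f (0 : Fin 2) (1 / 2) + onEdges f (1 : Fin 2) (1 / 2))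
    (fun f g _ _ a b => by
      change (a * onEdges f (0 : Fin 2) (1 / 2) + b * onEdges g (0 : Fin 2) (1 / 2))
        + (a * onEdges f (1 : Fin 2) (1 / 2) + b * onEdges g (1 : Fin 2) (1 / 2)) = _
      ring)
  obtain ⟨F, hF⟩ : ∃ F : Fin 2 → ℝ → ℝ, F = onEdges f := ⟨_, rfl⟩
  obtain ⟨g, hg⟩ : ∃ g : Fin 2 → ℝ → ℝ, g = f' := ⟨_, rfl⟩
  have hprim : ∀ k, IsPrimitiveOn (F k) (g k) 0 1 := fun k => by
    rw [hF, hg]; exact hf.isPrimitiveOn k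
  have hgg : ∀ j k, IntervalIntegrable (fun x => g j x * g k x) volume 0 1 := by
    intro j k
    rw [intervalIntegrable_iff_integrableOn_Ioo_of_le zero_le_one, hg]
    exact (hf.2.1 j).integrable_mul (hf.2.1 k)
  have hFc : ∀ k, ContinuousOn (F k) (Icc 0 1) := fun k => (hprim k).continuousOn zero_le_one
  have hFF : ∀ j k, IntervalIntegrable (fun x => F j x * F k x) volume 0 1 := fun j k =>
    ContinuousOn.intervalIntegrable (by
      rw [uIcc_of_le zero_le_one]; exact (hFc j).mul (hFc k))
  have hmid : F 0 (1 / 2) + F 1 (1 / 2) = 0 := by rw [hF]; exact hv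
  have hleft : F 0 0 = F 1 0 := by
    rw [hF]
    exact onEdges_eq_of_glue f (s := ((0 : Fin 2), false)) (t := ((1 : Fin 2), false)) rfl
  have hright : F 0 1 = F 1 1 := by
    rw [hF]
    exact onEdges_eq_of_glue f (s := ((0 : Fin 2), true)) (t := ((1 : Fin 2), true)) rfl
  have hn : innerL2 (onEdges f) (onEdges f)
      = (∫ x in (0 : ℝ)..1, F 0 x * F 0 x) + ∫ x in (0 : ℝ)..1, F 1 x * F 1 x := by
    rw [hF]
    exact Fin.sum_univ_two fun k => ∫ x in (0 : ℝ)..1, onEdges f k x * onEdges f k x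
  have hqq : innerL2 f' f'
      = (∫ x in (0 : ℝ)..1, g 0 x * g 0 x) + ∫ x in (0 : ℝ)..1, g 1 x * g 1 x := by
    rw [hg]
    exact Fin.sum_univ_two fun k => ∫ x in (0 : ℝ)..1, f' k x * f' k x
  have expand : ∀ {u : Fin 2 → ℝ → ℝ},
      (∀ j k, IntervalIntegrable (fun x => u j x * u k x) volume 0 1) → ∀ c : ℝ,
      IntervalIntegrable (fun x => (u 0 x + c * u 1 x) ^ 2) volume 0 1 ∧
      ∫ x in (0 : ℝ)..1, (u 0 x + c * u 1 x) ^ 2 = (∫ x in (0 : ℝ)..1, u 0 x * u 0 x)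
        + 2 * c * (∫ x in (0 : ℝ)..1, u 0 x * u 1 x)
        + c ^ 2 * ∫ x in (0 : ℝ)..1, u 1 x * u 1 x := by
    intro u hu c
    have e : (fun x => (u 0 x + c * u 1 x) ^ 2) = fun x => u 0 x * u 0 x
        + 2 * c * (u 0 x * u 1 x) + c ^ 2 * (u 1 x * u 1 x) := by funext x; ring
    have i1 := (hu 0 1).const_mul (2 * c)
    have i2 := (hu 1 1).const_mul (c ^ 2)
    rw [e, intervalIntegral.integral_add ((hu 0 0).add i1) i2,
      intervalIntegral.integral_add (hu 0 0) i1, intervalIntegral.integral_const_mul,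
      intervalIntegral.integral_const_mul]
    exact ⟨((hu 0 0).add i1).add i2, rfl⟩
  -- the difference, on the whole edge
  have hd := (hprim 0).add ((hprim 1).const_mul (-1))
  have ineq1 := hd.pi_div_sq_mul_integral_sq_le zero_le_one (expand hgg (-1)).1
    (c := 1 / 2) (r := 1 / 2) (by norm_num)
    (fun x hx => by rw [abs_le]; constructor <;> linarith [hx.1, hx.2])
    (Or.inl (by linarith)) (Or.inl (by linarith))
  -- the sum, on both halves of the edge
  have hs := (hprim 0).add ((hprim 1).const_mul 1)
  have hs2 := (expand hgg 1).1
  have hS2 := (expand hFF 1).1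
  have sub1 : ∀ {u : ℝ → ℝ}, IntervalIntegrable u volume 0 1 →
      IntervalIntegrable u volume 0 (1 / 2) := fun h => h.mono_set (by
    rw [uIcc_of_le zero_le_one, uIcc_of_le (by norm_num)]
    exact Icc_subset_Icc_right (by norm_num))
  have sub2 : ∀ {u : ℝ → ℝ}, IntervalIntegrable u volume 0 1 →
      IntervalIntegrable u volume (1 / 2) 1 := fun h => h.mono_set (by
    rw [uIcc_of_le zero_le_one, uIcc_of_le (by norm_num)]
    exact Icc_subset_Icc_left (by norm_num))
  have ineq2 := (hs.mono (c := 0) (d := 1 / 2) le_rfl (by norm_num)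
    (by norm_num)).pi_div_sq_mul_integral_sq_le (by norm_num) (sub1 hs2)
    (c := 0) (r := 1 / 2) (by norm_num)
    (fun x hx => by rw [abs_le]; constructor <;> linarith [hx.1, hx.2])
    (Or.inr rfl) (Or.inl (by linarith))
  have ineq3 := (hs.mono (c := 1 / 2) (d := 1) (by norm_num) (by norm_num)
    le_rfl).pi_div_sq_mul_integral_sq_le (by norm_num) (sub2 hs2)
    (c := 1) (r := 1 / 2) (by norm_num)
    (fun x hx => by rw [abs_le]; constructor <;> linarith [hx.1, hx.2])
    (Or.inl (by linarith)) (Or.inr rfl)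
  have split1 := intervalIntegral.integral_add_adjacent_intervals (sub1 hs2) (sub2 hs2)
  have split2 := intervalIntegral.integral_add_adjacent_intervals (sub1 hS2) (sub2 hS2)
  have hpi : Real.pi / (2 * (1 / 2)) = Real.pi := by norm_num
  rw [hpi] at ineq1 ineq2 ineq3
  have ineq4 : Real.pi ^ 2 * ∫ x in (0 : ℝ)..1, (F 0 x + 1 * F 1 x) ^ 2
      ≤ ∫ x in (0 : ℝ)..1, (g 0 x + 1 * g 1 x) ^ 2 := by
    rw [← split1, ← split2]
    linarith
  rw [(expand hFF _).2, (expand hgg _).2] at ineq1 ineq4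
  have hP : Real.pi ^ 2 * innerL2 (onEdges f) (onEdges f) ≤ innerL2 f' f' := by
    rw [hn, hqq]
    linarith
  exact le_of_mul_le_mul_right (hP.trans hq) (innerL2_self_pos hf.1 hf0)

end CompactMetricGraph

theorem mainTheorem2 :
    (∀ Γ : CompactMetricGraph, 0 < Γ.totalLength → ¬ Γ.IsSingleLoop →
      IsLeast (Γ.eigenvalueCountSet 2) (Γ.mu 2) ∧
      Γ.mu 2 ≤ Real.pi ^ 2 * (Γ.numEdges : ℝ) ^ 2 / Γ.totalLength ^ 2 ∧
      Real.pi ^ 2 * (Γ.numEdges : ℝ) ^ 2 / Γ.totalLength ^ 2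
        = Real.pi ^ 2 / Γ.meanEdgeLength ^ 2 ∧
      (Γ.IsFlower → Γ.IsEquilateral →
        Γ.mu 2 = Real.pi ^ 2 * (Γ.numEdges : ℝ) ^ 2 / Γ.totalLength ^ 2)) ∧
    (∃ Γ : CompactMetricGraph, 2 ≤ Γ.numEdges ∧ ¬ (Γ.IsFlower ∧ Γ.IsEquilateral) ∧
      IsLeast (Γ.eigenvalueCountSet 2) (Γ.mu 2) ∧
      Γ.mu 2 = Real.pi ^ 2 * (Γ.numEdges : ℝ) ^ 2 / Γ.totalLength ^ 2) := by
  refine ⟨fun Γ hL hΓ => ?_, CompactMetricGraph.twoPumpkin, le_rfl, ?_, ?_⟩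
  · obtain ⟨hleast, hle⟩ := CompactMetricGraph.isLeast_mu_two_and_le hL hΓ
    refine ⟨hleast, hle, ?_, fun hF hE => hle.antisymm
      (CompactMetricGraph.le_of_mem_eigenvalueCountSet_of_isFlower hL hF hE hleast.1)⟩
    rw [CompactMetricGraph.meanEdgeLength, div_pow, div_div_eq_mul_div]
  · rintro ⟨hF, -⟩
    have h : false = true := hF ((0 : Fin 2), false) ((0 : Fin 2), true)
    exact Bool.false_ne_true h
  · have hL : 0 < CompactMetricGraph.twoPumpkin.totalLength := by
      rw [CompactMetricGraph.totalLength_twoPumpkin]; norm_num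
    obtain ⟨hleast, hle⟩ := CompactMetricGraph.isLeast_mu_two_and_le hL
      fun h : CompactMetricGraph.twoPumpkin.IsSingleLoop => absurd h.1 (by decide)
    refine ⟨hleast, hle.antisymm ?_⟩
    have hge := CompactMetricGraph.le_of_mem_eigenvalueCountSet_twoPumpkin hleast.1
    have hn : (CompactMetricGraph.twoPumpkin.numEdges : ℝ) = 2 := by
      norm_num [CompactMetricGraph.twoPumpkin]
    rwa [CompactMetricGraph.totalLength_twoPumpkin, hn, mul_div_assoc, div_self (by norm_num),
      mul_one]
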